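/- In this statement graphs are finite and may have multiple edges and loops (a loop counts twice in the degree). For a graph $G$ with $n$ vertices, consider the following continuous-time random walk on $G$: when the walker arrives at a vertex (or starts there), independent alarm clocks are set on all edges, their ringing times being exponential random variables of rate $1$; the walker moves along the first edge at its current vertex whose clock rings, at the time at which it rings, and then everything is repeated with new independent clocks. Let $E_vT_u$ be the expected time until the walk started at $v$ first visits $u$, and let $\tau^*=\tau^*(G)=\max_{v,u}\,(E_vT_u+E_uT_v)$ be the maximal mean commute time. For real $\gamma$ and $\delta$ say that $G$ satisfies $I(\gamma,\delta)$ if for every set $A$ of vertices with $|A|\le n/2$ there are at least $\delta|A|^\gamma$ edges between $A$ and its complement. (1) For all real $1/2<\gamma<1$ and $\delta>0$ and every integer $D\ge 0$ there is a constant $K=K_{\gamma,\delta,D}>0$ such that every regular $n$-vertex graph $G$ of degree at most $D$ that satisfies $I(\gamma,\delta)$ has $\tau^*(G)\le K n$. (2) Without the bound on the degree this fails. There is an absolute constant $c>0$ such that for every $n\ge 3$ the graph with $n$ vertices arranged in a circle, in which any two neighbours are connected by $\lceil n^{2/3}\rceil$ parallel edges, is regular (of degree $2\lceil n^{2/3}\rceil$)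 and satisfies $I(2/3,1)$, but has $\tau^*> c\,n^{4/3}$. (3) It also fails without the bound on the degree if multiple edges are not allowed: there are $1/2<\gamma<1$ and $\delta>0$ such that for every real $K$ there is a regular graph $G$ without loops and multiple edges, on some number $n$ of vertices, that satisfies $I(\gamma,\delta)$ and has $\tau^*(G)>K n$. -/

import Mathlib

open MeasureTheory ProbabilityTheory
open scoped ENNReal Graph

universe u w

namespace MeanCommute

variable {V : Type u} {E : Type w}

/-- The degree of a vertex of a multigraph: the number of incident edges, loops counted twice. -/
noncomputable def degree (G : Graph V E) (x : V) : ℕ :=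
  {e | G.Inc e x}.ncard + {e | G.IsLoopAt e x}.ncard

/-- Every vertex has degree `d`. -/
def IsRegular (G : Graph V E) (d : ℕ) : Prop :=
  ∀ x ∈ V(G), degree G x = d

/-- The set of edges between `A` and the remaining vertices. -/
def edgeBoundary (G : Graph V E) (A : Set V) : Set E :=
  {e | ∃ x ∈ A, ∃ y ∈ V(G) \ A, G.IsLink e x y}

/-- For every set `A` of at most half of the vertices there are at least `δ |A| ^ γ` edges
between `A` and its complement. -/
def Isoperimetric (G : Graph V E) (γ δ : ℝ) : Prop :=
  ∀ A : Set V, A ⊆ V(G) → 2 * A.ncard ≤ V(G).ncard →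
    δ * (A.ncard : ℝ) ^ γ ≤ ((edgeBoundary G A).ncard : ℝ)

/-- The law of the alarm clocks: independent exponential variables of rate `1`, where `ω k e` is
the time that passes between the `k`-th move of the walk and the ringing of the clock on `e`
that is set at that move. -/
noncomputable def clockLaw (E : Type w) : Measure (ℕ → E → ℝ) :=
  Measure.infinitePi fun _ : ℕ => Measure.infinitePi fun _ : E => expMeasure 1

instance isProbabilityMeasure_clockLaw : IsProbabilityMeasure (clockLaw E) := by
  have : IsProbabilityMeasure (expMeasure 1) := isProbabilityMeasure_expMeasure one_pos
  unfold clockLaw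
  infer_instance

/-- The edges at `x` whose clocks ring first (almost surely at most one). -/
def firstToRing (G : Graph V E) (t : E → ℝ) (x : V) : Set E :=
  {e | G.Inc e x ∧ ∀ f, G.Inc f x → t e ≤ t f}

open Classical in
/-- The vertex reached from `x` along the first edge at `x` that rings
(`x` itself if there is no edge at `x`). -/
noncomputable def step (G : Graph V E) (t : E → ℝ) (x : V) : V :=
  if h : (firstToRing G t x).Nonempty then Graph.Inc.other h.some_mem.1 else x

/-- The time until the first edge at `x` rings (infinite if there is no edge at `x`). -/
noncomputable def waitingTime (G : Graph V E) (t : E → ℝ) (x : V) : ℝ≥0∞ :=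
  ⨅ (e : E) (_ : G.Inc e x), ENNReal.ofReal (t e)

/-- The vertex occupied after `k` moves by the walk started at `v`. -/
noncomputable def position (G : Graph V E) (ω : ℕ → E → ℝ) (v : V) : ℕ → V
  | 0 => v
  | k + 1 => step G (ω k) (position G ω v k)

/-- The time at which the walk started at `v` makes its `k`-th move. -/
noncomputable def moveTime (G : Graph V E) (ω : ℕ → E → ℝ) (v : V) (k : ℕ) : ℝ≥0∞ :=
  ∑ j ∈ Finset.range k, waitingTime G (ω j) (position G ω v j)

/-- The time at which the walk started at `v` first visits `u` (infinite if it never does). -/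
noncomputable def hittingTime (G : Graph V E) (ω : ℕ → E → ℝ) (v u : V) : ℝ≥0∞ :=
  ⨅ (k : ℕ) (_ : position G ω v k = u), moveTime G ω v k

/-- The expected hitting time of `u` by the walk started at `v`. -/
noncomputable def expectedHittingTime (G : Graph V E) (v u : V) : ℝ≥0∞ :=
  ∫⁻ ω, hittingTime G ω v u ∂(clockLaw E)

/-- The maximal mean commute time. -/
noncomputable def maxCommuteTime (G : Graph V E) : ℝ≥0∞ :=
  ⨆ v ∈ V(G), ⨆ u ∈ V(G), expectedHittingTime G v u + expectedHittingTime G u v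

/-- `n` vertices arranged in a circle, with `m` parallel edges between any two neighbours. -/
def thickCycle (n m : ℕ) : Graph (ZMod n) (ZMod n × Fin m) where
  vertexSet := Set.univ
  IsLink e x y := (x = e.1 ∧ y = e.1 + 1) ∨ (x = e.1 + 1 ∧ y = e.1)
  isLink_symm _ _ := ⟨fun _ _ h => by tauto⟩
  eq_or_eq_of_isLink_of_isLink _ _ _ _ _ h h' := by grind
  left_mem_of_isLink _ _ _ _ := Set.mem_univ _

end MeanCommute

/-! Fix a target `u` and let `h y` be the expected time to reach `u` from `y`. The first of the
clocks at `x` is uniformly distributed among the edges at `x` (`lintegral_step`) and rings after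
mean time one over their number (`lintegral_waitingTime`). Since the rounds are independent
(`lintegral_clockLaw`), conditioning on the first move gives that `h` has Laplacian `1` away from
`u` and vanishes at `u` (`laplacian_expectedHittingTime`). This needs `h` finite, which follows from
a barrier function on a connected graph. After that the arguments are deterministic and rest on
Green's identity `sum_mul_laplacian`.

Upper bound: sort the vertices by `h`, let `g j` be the increase of `h` from position `j` to `j +
1`, `C j` the edges over that gap, and `m j` the number of vertices on the smaller side. Green's
identity with the indicator of the upper side bounds the flow over each cut by the number `n` of
vertices. Splitting the drop along each edge into gaps, this reads `∑ j, |C i ∩ C j| * g j ≤ n` for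
every `i`. Add these inequalities with weights `m i ^ (-2γ)`, whose sum is bounded because `2γ > 1`.
The coefficient of `g j` is bounded below: since degrees are bounded, of order `m j ^ γ` cuts next
to the `j`-th one still share half of the guaranteed `δ * m j ^ γ` edges, and those chosen towards
the nearer end have weight at least `m j ^ (-2γ)`. Hence the total increase of `h` is `O(n)`
(`potential_drop_le`, `potential_le`).

Lower bounds: if `φ u = 0`, Green's identity gives `∑ φ = ∑ φ * Δh = ∑ h * Δφ`, so `Δφ ≤ c` forces
`∑ φ ≤ c * n * τ*` (`le_maxCommuteTime`). The parabola `i * (l - i)` on a cycle of length `l` has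
Laplacian at most `2` and sum of order `l ^ 3`. With `m` parallel edges this yields `τ*` of order at
least `l ^ 2 / m`. Replacing vertices by independent sets of size `s` yields order at least `l ^ 2 /
s` without multiple edges. -/

namespace MeanCommute

/-! ### One round of alarm clocks. -/

section

variable {V : Type u} {E : Type w}

/-- The law of one set of alarm clocks. -/
noncomputable def roundLaw (E : Type w) : Measure (E → ℝ) :=
  Measure.infinitePi fun _ : E => expMeasure 1

instance isProbabilityMeasure_exp_one : IsProbabilityMeasure (expMeasure 1) :=
  isProbabilityMeasure_expMeasure one_pos

instance isProbabilityMeasure_roundLaw : IsProbabilityMeasure (roundLaw E) := by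
  unfold roundLaw
  infer_instance

instance nullSingletonClass_exp_one : NullSingletonClass (expMeasure 1) := by
  unfold expMeasure gammaMeasure
  infer_instance

theorem expMeasure_one_Ioi {s : ℝ} (hs : 0 ≤ s) :
    expMeasure 1 (Set.Ioi s) = ENNReal.ofReal (Real.exp (-s)) := by
  have h := cdf_expMeasure_eq one_pos s
  rw [cdf_eq_real, if_pos hs, one_mul] at h
  have h2 := probReal_compl_eq_one_sub (μ := expMeasure 1) (measurableSet_Iic (a := s))
  rw [h, Set.compl_Iic] at h2
  rw [← ENNReal.ofReal_toReal (measure_ne_top (expMeasure 1) (Set.Ioi s))]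
  congr 1
  rw [← measureReal_def, h2]
  ring

/-- Two different clocks have a product law with atomless factors, so Fubini makes the diagonal
null. -/
theorem roundLaw_tie {e f : E} (hef : e ≠ f) : roundLaw E {t | t e = t f} = 0 := by
  have h := Measure.infinitePi_map_eval_prod (P := fun _ : E => expMeasure 1) hef
  have h2 : ((expMeasure 1).prod (expMeasure 1)) {p : ℝ × ℝ | p.1 = p.2} = 0 := by
    rw [Measure.measure_prod_null (measurableSet_eq_fun measurable_fst measurable_snd)]
    refine Filter.Eventually.of_forall fun x => ?_
    have : (Prod.mk x ⁻¹' {p : ℝ × ℝ | p.1 = p.2}) = {x} := by ext; simp [eq_comm]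
    simp [this]
  rw [← h, Measure.map_apply (by fun_prop)
    (measurableSet_eq_fun measurable_fst measurable_snd)] at h2
  exact h2

open Classical in
/-- The end of `e` other than `x`. -/
noncomputable def otherEnd (G : Graph V E) (e : E) (x : V) : V :=
  if h : G.Inc e x then h.other else x

theorem isLink_otherEnd {G : Graph V E} {e : E} {x : V} (h : G.Inc e x) :
    G.IsLink e x (otherEnd G e x) := by
  simp [otherEnd, h]

/-- `step` makes an arbitrary choice among the first edges to ring; without ties the choice is
forced. -/
theorem step_eq_otherEnd {G : Graph V E} {x : V} {e : E} {t : E → ℝ}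
    (he : e ∈ firstToRing G t x) (ht : ∀ f, f ≠ e → t f ≠ t e) :
    step G t x = otherEnd G e x := by
  have h : (firstToRing G t x).Nonempty := ⟨e, he⟩
  have h2 : h.some = e := by
    by_contra hne
    exact ht _ hne (le_antisymm (h.some_mem.2 e he.1) (he.2 _ h.some_mem.1))
  simp only [step, h, dite_true]
  have h3 : h.some_mem.1.other = otherEnd G h.some x := by simp [otherEnd, h.some_mem.1]
  rw [h3, h2]

section Incidence

variable [Finite E]

open Classical in
/-- The edges at `x`. -/
noncomputable def incEdges (G : Graph V E) (x : V) : Finset E :=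
  (Set.toFinite {e | G.Inc e x}).toFinset

@[simp]
theorem mem_incEdges {G : Graph V E} {x : V} {e : E} : e ∈ incEdges G x ↔ G.Inc e x := by
  simp [incEdges]

theorem measurableSet_mem_firstToRing (G : Graph V E) (x : V) (e : E) :
    MeasurableSet {t : E → ℝ | e ∈ firstToRing G t x} := by
  by_cases he : G.Inc e x
  · have : {t : E → ℝ | e ∈ firstToRing G t x} = ⋂ (f) (_ : G.Inc f x), {t | t e ≤ t f} := by
      ext t; simp [firstToRing, he]
    rw [this]
    exact MeasurableSet.iInter fun f => MeasurableSet.iInter fun _ =>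
      measurableSet_le (by fun_prop) (by fun_prop)
  · simp [firstToRing, he]

theorem measurable_step (G : Graph V E) (x : V) [MeasurableSpace V] :
    Measurable fun t : E → ℝ => step G t x := by
  classical
  let _ : MeasurableSpace (Set E) := ⊤
  have h1 : Measurable fun t : E → ℝ => firstToRing G t x := by
    refine measurable_to_countable' fun S => ?_
    have : (fun t : E → ℝ => firstToRing G t x) ⁻¹' {S} =
        ⋂ e, if e ∈ S then {t | e ∈ firstToRing G t x} else {t | e ∈ firstToRing G t x}ᶜ := by
      ext t
      simp only [Set.mem_preimage, Set.mem_singleton_iff, Set.ext_iff, Set.mem_iInter]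
      refine forall_congr' fun e => ?_
      by_cases he : e ∈ S <;> simp [he]
    rw [this]
    refine MeasurableSet.iInter fun e => ?_
    split_ifs
    exacts [measurableSet_mem_firstToRing G x e, (measurableSet_mem_firstToRing G x e).compl]
  -- The step depends on the clocks only through the set of first edges, which takes finitely many
  -- values, so the arbitrary choice does no harm to measurability.
  let F : Set E → V := fun S => if h : S.Nonempty then otherEnd G h.some x else x
  have h2 : (fun t : E → ℝ => step G t x) = F ∘ fun t => firstToRing G t x := by
    funext t
    simp only [step, F, Function.comp]
    split_ifs with h
    · simp [otherEnd, h.some_mem.1]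
    · rfl
  rw [h2]
  exact measurable_from_top.comp h1

theorem exists_mem_firstToRing (G : Graph V E) (x : V) (h : (incEdges G x).Nonempty)
    (t : E → ℝ) : ∃ e, e ∈ firstToRing G t x := by
  obtain ⟨e, he, h2⟩ := (incEdges G x).exists_min_image t h
  exact ⟨e, by simpa using he, fun f hf => h2 f (by simpa using hf)⟩

theorem ae_injective : ∀ᵐ t ∂roundLaw E, ∀ e f : E, f ≠ e → t f ≠ t e := by
  have := Fintype.ofFinite E
  refine ae_all_iff.2 fun e => ae_all_iff.2 fun f => ?_
  by_cases hef : f = e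
  · simp [hef]
  · have := roundLaw_tie hef
    refine (measure_eq_zero_iff_ae_notMem.1 this).mono fun t ht _ => ht

/-- Swapping the clocks of `e` and `f` preserves the law and the set of edges at `x`. -/
theorem roundLaw_firstToRing_eq (G : Graph V E) (x : V) {e f : E} (he : G.Inc e x)
    (hf : G.Inc f x) :
    roundLaw E {t | e ∈ firstToRing G t x} = roundLaw E {t | f ∈ firstToRing G t x} := by
  classical
  let σ : Equiv.Perm E := Equiv.swap e f
  have h := Measure.map_infinitePi_infinitePi_of_inj (P := fun _ : E => expMeasure 1) σ.injective
  have h2 : (roundLaw E).map (fun t i => t (σ i)) = roundLaw E := h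
  conv_lhs => rw [← h2]
  rw [Measure.map_apply (by fun_prop) (measurableSet_mem_firstToRing G x e)]
  congr 1
  ext t
  have hσ : ∀ g, G.Inc g x → G.Inc (σ g) x := by
    intro g hg
    simp only [σ, Equiv.swap_apply_def]
    split_ifs <;> assumption
  simp only [firstToRing, Set.mem_preimage, Set.mem_ofPred_eq]
  constructor
  · rintro ⟨-, h⟩
    refine ⟨hf, fun g hg => ?_⟩
    have := h (σ g) (hσ g hg)
    simpa [σ] using this
  · rintro ⟨-, h⟩
    refine ⟨he, fun g hg => ?_⟩
    have := h (σ g) (hσ g hg)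
    simpa [σ] using this

theorem lintegral_step (G : Graph V E) (x : V) (h : (incEdges G x).Nonempty) (F : V → ℝ≥0∞) :
    ∫⁻ t, F (step G t x) ∂roundLaw E =
      ((incEdges G x).card : ℝ≥0∞)⁻¹ * ∑ e ∈ incEdges G x, F (otherEnd G e x) := by
  classical
  let A : E → Set (E → ℝ) := fun e => {t | e ∈ firstToRing G t x}
  have key : ∀ F : V → ℝ≥0∞, ∫⁻ t, F (step G t x) ∂roundLaw E =
      ∑ e ∈ incEdges G x, F (otherEnd G e x) * roundLaw E (A e) := by
    intro F
    have h1 : ∀ᵐ t ∂roundLaw E, F (step G t x) =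
        ∑ e ∈ incEdges G x, (A e).indicator (fun _ => F (otherEnd G e x)) t := by
      filter_upwards [ae_injective (E := E)] with t ht
      obtain ⟨e, he⟩ := exists_mem_firstToRing G x h t
      rw [step_eq_otherEnd he (ht e), Finset.sum_eq_single e]
      · simp [A, he]
      · intro f hf hfe
        rw [Set.indicator_of_notMem]
        intro hf2
        exact ht e f hfe (le_antisymm (hf2.2 e he.1) (he.2 f hf2.1))
      · intro hn
        exact absurd (mem_incEdges.2 he.1) hn
    rw [lintegral_congr_ae h1, lintegral_finsetSum]
    · refine Finset.sum_congr rfl fun e _ => ?_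
      rw [lintegral_indicator (measurableSet_mem_firstToRing G x e)]
      simp [A]
    · exact fun e _ => measurable_const.indicator (measurableSet_mem_firstToRing G x e)
  obtain ⟨e₀, he₀⟩ := h
  have hp : ∀ e ∈ incEdges G x, roundLaw E (A e) = roundLaw E (A e₀) := fun e he =>
    roundLaw_firstToRing_eq G x (by simpa using he) (by simpa using he₀)
  -- A constant test function says that the equal probabilities add up to `1`, which determines
  -- them.
  have h1 := key fun _ => 1
  rw [Finset.sum_congr rfl fun e he => by rw [hp e he]] at h1
  simp only [lintegral_const, measure_univ, one_mul, mul_one, Finset.sum_const,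
    nsmul_eq_mul] at h1
  have h2 : roundLaw E (A e₀) = ((incEdges G x).card : ℝ≥0∞)⁻¹ := by
    refine ENNReal.eq_inv_of_mul_eq_one_left ?_
    rw [mul_comm]
    exact h1.symm
  rw [key, Finset.sum_congr rfl fun e he => by rw [hp e he], ← Finset.sum_mul, mul_comm, h2]

theorem measurable_waitingTime (G : Graph V E) (x : V) :
    Measurable fun t : E → ℝ => waitingTime G t x := by
  unfold waitingTime
  exact Measurable.iInf fun e => Measurable.iInf fun _ => by fun_prop

theorem lintegral_exp_neg_mul {r : ℝ} (hr : 0 < r) :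
    ∫⁻ s in Set.Ioi (0 : ℝ), ENNReal.ofReal (Real.exp (-r * s)) = ENNReal.ofReal r⁻¹ := by
  rw [← ofReal_integral_eq_lintegral_ofReal]
  · rw [integral_exp_mul_Ioi (by linarith)]
    simp
  · exact integrableOn_exp_mul_Ioi (by linarith) 0
  · exact Filter.Eventually.of_forall fun s => (Real.exp_pos _).le

/-- The waiting time is a minimum of independent exponentials; its tail is the product of their
tails, and the layer-cake formula integrates it. -/
theorem lintegral_waitingTime (G : Graph V E) (x : V) (h : (incEdges G x).Nonempty) :
    ∫⁻ t, waitingTime G t x ∂roundLaw E = ((incEdges G x).card : ℝ≥0∞)⁻¹ := by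
  classical
  let m : (E → ℝ) → ℝ := fun t => (incEdges G x).inf' h t
  have hm : Measurable m := by
    have : m = (incEdges G x).inf' h fun e t => t e := by
      funext t; simp [m, Finset.inf'_apply]
    rw [this]
    exact Finset.inf'_induction h _ (fun f hf g hg => hf.inf hg) fun e _ => by fun_prop
  have h1 : ∀ t, waitingTime G t x = ENNReal.ofReal (m t) := by
    intro t
    refine le_antisymm ?_ ?_
    · obtain ⟨e, he, h2⟩ := (incEdges G x).exists_mem_eq_inf' h t
      simp only [m, h2]
      exact iInf₂_le e (by simpa using he)
    · refine le_iInf₂ fun e he => ENNReal.ofReal_le_ofReal ?_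
      exact Finset.inf'_le _ (by simpa using he)
  simp_rw [h1]
  have hlt : ∀ s : ℝ, {t | s < m t} = Set.pi (incEdges G x : Set E) fun _ => Set.Ioi s := by
    intro s; ext t; simp [m, Set.mem_pi]
  have hP : ∀ s : ℝ, 0 ≤ s → roundLaw E {t | s < m t} =
      ENNReal.ofReal (Real.exp (-((incEdges G x).card : ℝ) * s)) := by
    intro s hs
    rw [hlt, roundLaw, Measure.infinitePi_pi _ fun _ _ => measurableSet_Ioi]
    rw [Finset.prod_congr rfl fun _ _ => expMeasure_one_Ioi hs, Finset.prod_const,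
      ← ENNReal.ofReal_pow (Real.exp_pos _).le, ← Real.exp_nat_mul]
    congr 2; ring
  have h0 : 0 ≤ᵐ[roundLaw E] m := by
    have : roundLaw E {t | 0 < m t} = 1 := by rw [hP 0 le_rfl]; simp
    have h3 : ∀ᵐ t ∂roundLaw E, 0 < m t := by
      rw [← prob_compl_eq_zero_iff (measurableSet_lt measurable_const hm)] at this
      exact this
    exact h3.mono fun t ht => ht.le
  rw [lintegral_eq_lintegral_meas_lt _ h0 hm.aemeasurable]
  rw [setLIntegral_congr_fun measurableSet_Ioi fun s hs => hP s (le_of_lt hs)]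
  have hr : (0 : ℝ) < (incEdges G x).card := by exact_mod_cast h.card_pos
  rw [lintegral_exp_neg_mul hr, ENNReal.ofReal_inv_of_pos hr, ENNReal.ofReal_natCast]

end Incidence

/-! ### Independence of the rounds and first-step analysis. -/

/-- Forgetting the first set of alarm clocks. -/
def shift (ω : ℕ → E → ℝ) : ℕ → E → ℝ := fun k => ω (k + 1)

theorem measurable_shift : Measurable (shift (E := E)) :=
  measurable_pi_lambda _ fun k => measurable_pi_apply (k + 1)

/-- It is easier to check the inverse map `c`, which puts a round in front of a sequence: on a
cylinder the product measure is the required finite product. -/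
theorem map_clockLaw :
    (clockLaw E).map (fun ω => (ω 0, shift ω)) = (roundLaw E).prod (clockLaw E) := by
  let c : (E → ℝ) × (ℕ → E → ℝ) → ℕ → E → ℝ := fun p k => Nat.casesOn k p.1 p.2
  have hc : Measurable c := by
    refine measurable_pi_lambda _ fun k => ?_
    cases k with
    | zero => exact measurable_fst
    | succ k => exact (measurable_pi_apply k).comp measurable_snd
  have h : ((roundLaw E).prod (clockLaw E)).map c = clockLaw E := by
    refine Measure.eq_infinitePi _ fun s t ht => ?_
    classical
    obtain ⟨N, hN⟩ : ∃ N, s ⊆ Finset.range (N + 1) :=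
      ⟨s.sup id, fun i hi => Finset.mem_range.2 (Nat.lt_succ_of_le (Finset.le_sup (f := id) hi))⟩
    let t' : ℕ → Set (E → ℝ) := fun i => if i ∈ s then t i else Set.univ
    have ht' : ∀ i, MeasurableSet (t' i) := fun i => by
      simp only [t']; split_ifs; exacts [ht i, .univ]
    have h1 : c ⁻¹' Set.pi (s : Set ℕ) t =
        t' 0 ×ˢ Set.pi (Finset.range N : Set ℕ) fun i => t' (i + 1) := by
      ext ⟨a, b⟩
      simp only [Set.mem_preimage, Set.mem_pi, Set.mem_prod, Finset.coe_range, Set.mem_Iio,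
        Finset.mem_coe, t']
      constructor
      · intro h
        refine ⟨?_, fun i _ => ?_⟩
        · split_ifs with h0
          · exact h 0 h0
          · trivial
        · split_ifs with h0
          · exact h (i + 1) h0
          · trivial
      · rintro ⟨h0, h1⟩ i hi
        cases i with
        | zero => simpa [hi, c] using h0
        | succ i =>
          have h2 := Finset.mem_range.1 (hN hi)
          simpa [hi, c] using h1 i (by omega)
    rw [Measure.map_apply hc (.pi s.countable_toSet fun _ _ => ht _), h1, Measure.prod_prod,
      clockLaw, Measure.infinitePi_pi _ fun i _ => ht' (i + 1)]
    have h2 : ∏ i ∈ s, Measure.infinitePi (fun _ : E => expMeasure 1) (t i) =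
        ∏ i ∈ Finset.range (N + 1), Measure.infinitePi (fun _ : E => expMeasure 1) (t' i) := by
      rw [← Finset.prod_subset hN]
      · exact Finset.prod_congr rfl fun i hi => by simp [t', hi]
      · intro i _ hi
        simp [t', hi]
    rw [h2, Finset.prod_range_succ', mul_comm]
    rfl
  have hd : Measurable fun ω : ℕ → E → ℝ => (ω 0, shift ω) :=
    (measurable_pi_apply 0).prodMk measurable_shift
  conv_lhs => rw [← h, Measure.map_map hd hc]
  exact Measure.map_id

theorem lintegral_clockLaw {F : (E → ℝ) × (ℕ → E → ℝ) → ℝ≥0∞} (hF : Measurable F) :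
    ∫⁻ ω, F (ω 0, shift ω) ∂clockLaw E = ∫⁻ t, ∫⁻ ω, F (t, ω) ∂clockLaw E ∂roundLaw E := by
  rw [← lintegral_prod _ hF.aemeasurable, ← map_clockLaw, lintegral_map hF]
  exact (measurable_pi_apply 0).prodMk measurable_shift

end

section

variable {V : Type u} {E : Type w}

theorem position_succ' (G : Graph V E) (ω : ℕ → E → ℝ) (v : V) (k : ℕ) :
    position G ω v (k + 1) = position G (shift ω) (step G (ω 0) v) k := by
  induction k with
  | zero => rfl
  | succ k ih =>
    rw [position, ih]
    rfl

theorem moveTime_succ' (G : Graph V E) (ω : ℕ → E → ℝ) (v : V) (k : ℕ) :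
    moveTime G ω v (k + 1) =
      waitingTime G (ω 0) v + moveTime G (shift ω) (step G (ω 0) v) k := by
  rw [moveTime, Finset.sum_range_succ', add_comm]
  congr 1
  refine Finset.sum_congr rfl fun j _ => ?_
  rw [position_succ']
  rfl

theorem hittingTime_self (G : Graph V E) (ω : ℕ → E → ℝ) (u : V) : hittingTime G ω u u = 0 := by
  have h : hittingTime G ω u u ≤ moveTime G ω u 0 := 
    iInf₂_le (f := fun k (_ : position G ω u k = u) => moveTime G ω u k) 0 rfl
  simpa [moveTime] using h

theorem hittingTime_of_ne (G : Graph V E) (ω : ℕ → E → ℝ) {v u : V} (h : v ≠ u) :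
    hittingTime G ω v u =
      waitingTime G (ω 0) v + hittingTime G (shift ω) (step G (ω 0) v) u := by
  unfold hittingTime
  rw [ENNReal.add_iInf₂]
  refine le_antisymm (le_iInf₂ fun k hk => ?_) (le_iInf₂ fun k hk => ?_)
  · rw [← moveTime_succ']
    exact iInf₂_le (k + 1) (by rwa [position_succ'])
  · cases k with
    | zero => exact absurd hk h
    | succ k =>
      rw [moveTime_succ']
      exact iInf₂_le k (by rwa [← position_succ'])

theorem expectedHittingTime_self (G : Graph V E) (u : V) : expectedHittingTime G u u = 0 := by
  simp [expectedHittingTime, hittingTime_self]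

open Classical in
/-- The sum, over the first `k` moves, of the waiting times plus one before the visit of `u`. -/
noncomputable def stoppedSum (G : Graph V E) (u : V) : ℕ → (ℕ → E → ℝ) → V → ℝ≥0∞
  | 0, _, _ => 0
  | k + 1, ω, v => if v = u then 0 else
      waitingTime G (ω 0) v + 1 + stoppedSum G u k (shift ω) (step G (ω 0) v)

theorem hittingTime_le_iSup_stoppedSum (G : Graph V E) (u : V) (ω : ℕ → E → ℝ) (v : V) :
    hittingTime G ω v u ≤ ⨆ k, stoppedSum G u k ω v := by
  by_cases h : ∃ k, position G ω v k = u
  · obtain ⟨k, hk⟩ := h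
    refine le_trans ?_ (le_iSup _ k)
    induction k generalizing ω v with
    | zero =>
      obtain rfl : v = u := hk
      simp [hittingTime_self]
    | succ k ih =>
      by_cases hv : v = u
      · simp [hv, hittingTime_self]
      · rw [hittingTime_of_ne G ω hv, stoppedSum, if_neg hv]
        rw [position_succ'] at hk
        exact add_le_add le_self_add (ih _ _ hk)
  -- If `u` is never visited the hitting time is infinite. The extra `1` per move makes the stopped
  -- sums diverge too, with no need to study the sum of the waiting times.
  · have h2 : ∀ (k : ℕ) (ω : ℕ → E → ℝ) (v : V), (∀ k, position G ω v k ≠ u) →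
        (k : ℝ≥0∞) ≤ stoppedSum G u k ω v := by
      intro k
      induction k with
      | zero => simp
      | succ k ih =>
        intro ω v h
        have hv : v ≠ u := h 0
        rw [stoppedSum, if_neg hv, Nat.cast_succ, add_comm]
        refine add_le_add le_add_self (ih _ _ fun k => ?_)
        rw [← position_succ']
        exact h (k + 1)
    push Not at h
    have : ⨆ k, stoppedSum G u k ω v = ⊤ :=
      top_unique <| ENNReal.iSup_natCast.symm.le.trans (iSup_mono fun k => h2 k ω v h)
    simp [this]

theorem monotone_stoppedSum (G : Graph V E) (u : V) (ω : ℕ → E → ℝ) (v : V) :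
    Monotone fun k => stoppedSum G u k ω v := by
  refine monotone_nat_of_le_succ fun k => ?_
  induction k generalizing ω v with
  | zero => simp [stoppedSum]
  | succ k ih =>
    by_cases hv : v = u
    · simp [stoppedSum, hv]
    · rw [stoppedSum, stoppedSum, if_neg hv, if_neg hv]
      gcongr
      exact ih _ _

theorem measurable_comp_split {F : (E → ℝ) × (ℕ → E → ℝ) → ℝ≥0∞} (hF : Measurable F) :
    Measurable fun ω => F (ω 0, shift ω) :=
  hF.comp ((measurable_pi_apply 0).prodMk measurable_shift)

section Finite

variable [Finite V] [Finite E]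

theorem measurable_comp_step (G : Graph V E) (x : V) {F : (ℕ → E → ℝ) → V → ℝ≥0∞}
    (hF : ∀ y, Measurable fun ω => F ω y) :
    Measurable fun p : (E → ℝ) × (ℕ → E → ℝ) => F p.2 (step G p.1 x) := by
  let _ : MeasurableSpace V := ⊤
  have h1 : Measurable fun p : V × (ℕ → E → ℝ) => F p.2 p.1 :=
    measurable_from_prod_countable_right hF
  exact h1.comp (((measurable_step G x).comp measurable_fst).prodMk measurable_snd)

theorem measurable_waitingTime_add_comp_step (G : Graph V E) (x : V) (c : ℝ≥0∞)
    {F : (ℕ → E → ℝ) → V → ℝ≥0∞} (hF : ∀ y, Measurable fun ω => F ω y) :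
    Measurable fun p : (E → ℝ) × (ℕ → E → ℝ) =>
      waitingTime G p.1 x + c + F p.2 (step G p.1 x) :=
  (((measurable_waitingTime G x).comp measurable_fst).add measurable_const).add
    (measurable_comp_step G x hF)

theorem lintegral_waitingTime_add_comp_step (G : Graph V E) {x : V}
    (hx : (incEdges G x).Nonempty) (c : ℝ≥0∞)
    {F : (ℕ → E → ℝ) → V → ℝ≥0∞} (hF : ∀ y, Measurable fun ω => F ω y) :
    ∫⁻ ω, waitingTime G (ω 0) x + c + F (shift ω) (step G (ω 0) x) ∂clockLaw E =
      ((incEdges G x).card : ℝ≥0∞)⁻¹ + c + ((incEdges G x).card : ℝ≥0∞)⁻¹ *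
        ∑ e ∈ incEdges G x, ∫⁻ ω, F ω (otherEnd G e x) ∂clockLaw E := by
  rw [lintegral_clockLaw (measurable_waitingTime_add_comp_step G x c hF)]
  have h2 : ∀ t : E → ℝ, ∫⁻ ω, waitingTime G t x + c + F ω (step G t x) ∂clockLaw E =
      waitingTime G t x + c + ∫⁻ ω, F ω (step G t x) ∂clockLaw E := by
    intro t
    rw [lintegral_add_left measurable_const]
    simp
  simp_rw [h2]
  have hm : Measurable fun t : E → ℝ => waitingTime G t x + c :=
    (measurable_waitingTime G x).add measurable_const
  rw [lintegral_add_left hm, lintegral_add_left (measurable_waitingTime G x),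
    lintegral_waitingTime G x hx, lintegral_step G x hx fun y => ∫⁻ ω, F ω y ∂clockLaw E]
  simp

theorem measurableSet_position_eq (G : Graph V E) (v u : V) (k : ℕ) :
    MeasurableSet {ω : ℕ → E → ℝ | position G ω v k = u} := by
  let _ : MeasurableSpace V := ⊤
  have h : Measurable fun ω : ℕ → E → ℝ => position G ω v k := by
    induction k with
    | zero => exact measurable_const
    | succ k ih =>
      have h1 : Measurable fun p : V × (E → ℝ) => step G p.2 p.1 :=
        measurable_from_prod_countable_right fun x => measurable_step G x
      exact h1.comp (ih.prodMk (measurable_pi_apply k))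
  exact h (measurableSet_singleton u)

theorem measurable_moveTime (G : Graph V E) (k : ℕ) (v : V) :
    Measurable fun ω : ℕ → E → ℝ => moveTime G ω v k := by
  induction k generalizing v with
  | zero => simp [moveTime]
  | succ k ih =>
    simp_rw [moveTime_succ']
    simpa using measurable_comp_split (measurable_waitingTime_add_comp_step G v 0 ih)

theorem measurable_hittingTime (G : Graph V E) (v u : V) :
    Measurable fun ω : ℕ → E → ℝ => hittingTime G ω v u := by
  classical
  unfold hittingTime
  refine Measurable.iInf fun k => ?_
  simp_rw [iInf_eq_if]
  exact Measurable.ite (measurableSet_position_eq G v u k) (measurable_moveTime G k v)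
    measurable_const

theorem expectedHittingTime_of_ne (G : Graph V E) {x u : V} (hxu : x ≠ u)
    (hx : (incEdges G x).Nonempty) :
    expectedHittingTime G x u = ((incEdges G x).card : ℝ≥0∞)⁻¹ *
      (1 + ∑ e ∈ incEdges G x, expectedHittingTime G (otherEnd G e x) u) := by
  have h := lintegral_waitingTime_add_comp_step G hx 0 (F := fun ω y => hittingTime G ω y u)
    fun y => measurable_hittingTime G y u
  simp only [add_zero, ← hittingTime_of_ne G _ hxu] at h
  rw [expectedHittingTime, h, mul_add, mul_one]
  rfl

theorem measurable_stoppedSum (G : Graph V E) (u : V) (k : ℕ) (v : V) :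
    Measurable fun ω : ℕ → E → ℝ => stoppedSum G u k ω v := by
  induction k generalizing v with
  | zero => exact measurable_const
  | succ k ih =>
    by_cases hv : v = u
    · simp [stoppedSum, hv]
    · simp only [stoppedSum, if_neg hv]
      exact measurable_comp_split (measurable_waitingTime_add_comp_step G v 1 ih)

/-- A nonnegative supersolution bounds the expected hitting times. -/
theorem expectedHittingTime_le_of_supersolution (G : Graph V E) (u : V) (g : V → ℝ≥0∞)
    (hr : ∀ x ∈ V(G), x ≠ u → (incEdges G x).Nonempty)
    (hg : ∀ x ∈ V(G), x ≠ u →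
      1 + (incEdges G x).card + ∑ e ∈ incEdges G x, g (otherEnd G e x) ≤
        (incEdges G x).card * g x)
    {v : V} (hv : v ∈ V(G)) : expectedHittingTime G v u ≤ g v := by
  -- The truncated sums start at `0`, so the supersolution inequality propagates by induction;
  -- monotone convergence then removes the truncation.
  have key : ∀ k, ∀ v ∈ V(G), ∫⁻ ω, stoppedSum G u k ω v ∂clockLaw E ≤ g v := by
    intro k
    induction k with
    | zero => simp [stoppedSum]
    | succ k ih =>
      intro v hv
      by_cases hvu : v = u
      · simp [stoppedSum, hvu]
      simp only [stoppedSum, if_neg hvu]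
      rw [lintegral_waitingTime_add_comp_step G (hr v hv hvu) 1 (measurable_stoppedSum G u k)]
      have hc0 : ((incEdges G v).card : ℝ≥0∞) ≠ 0 := by
        exact_mod_cast (hr v hv hvu).card_pos.ne'
      have hct : ((incEdges G v).card : ℝ≥0∞) ≠ ⊤ := ENNReal.natCast_ne_top _
      rw [← ENNReal.mul_le_mul_iff_right hc0 hct]
      refine le_trans (le_of_eq ?_) ((add_le_add_right (Finset.sum_le_sum fun e he =>
        ih _ (isLink_otherEnd (mem_incEdges.1 he)).right_mem) _).trans (hg v hv hvu))
      rw [mul_add, mul_add, ← mul_assoc, ENNReal.mul_inv_cancel hc0 hct, one_mul, mul_one]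
  refine (lintegral_mono fun ω => hittingTime_le_iSup_stoppedSum G u ω v).trans ?_
  rw [lintegral_iSup (fun k => measurable_stoppedSum G u k v)
    fun i j hij ω => monotone_stoppedSum G u ω v hij]
  exact iSup_le fun k => key k v hv

end Finite

end

/-! ### Laplacian, Green's identity and finiteness of hitting times. -/

section

variable {V : Type u} {E : Type w}

theorem otherEnd_of_isLink {G : Graph V E} {e : E} {x y : V} (h : G.IsLink e x y) :
    otherEnd G e x = y :=
  (isLink_otherEnd h.inc_left).right_unique h

section Finite

variable [Finite V] [Finite E]

/-- The vertices as a finset. -/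
noncomputable def vertices (G : Graph V E) : Finset V := (Set.toFinite V(G)).toFinset

omit [Finite E] in
@[simp]
theorem mem_vertices {G : Graph V E} {x : V} : x ∈ vertices G ↔ x ∈ V(G) := by
  simp [vertices]

omit [Finite E] in
theorem card_vertices (G : Graph V E) : (vertices G).card = V(G).ncard :=
  (Set.ncard_eq_toFinset_card _ _).symm

/-- The edges as a finset. -/
noncomputable def edges (G : Graph V E) : Finset E := (Set.toFinite E(G)).toFinset

omit [Finite V] in
@[simp]
theorem mem_edges {G : Graph V E} {e : E} : e ∈ edges G ↔ e ∈ E(G) := by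
  simp [edges]

/-- The graph Laplacian. -/
noncomputable def laplacian (G : Graph V E) (h : V → ℝ) (x : V) : ℝ :=
  ∑ e ∈ incEdges G x, (h x - h (otherEnd G e x))

/-- Exchange the sums over vertices and edges: a non-loop contributes once from each end, a loop
contributes zero on both sides. The orientation is irrelevant. -/
theorem sum_mul_laplacian (G : Graph V E) {s t : E → V}
    (hst : ∀ e ∈ E(G), G.IsLink e (s e) (t e)) (φ h : V → ℝ) :
    ∑ x ∈ vertices G, φ x * laplacian G h x =
      ∑ e ∈ edges G, (φ (s e) - φ (t e)) * (h (s e) - h (t e)) := by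
  classical
  simp_rw [laplacian, Finset.mul_sum]
  rw [Finset.sum_comm' (t' := edges G) (s' := fun e => {s e, t e})]
  · refine Finset.sum_congr rfl fun e he => ?_
    have hl := hst e (mem_edges.1 he)
    by_cases hne : s e = t e
    · simp only [hne, Finset.pair_eq_singleton, Finset.sum_singleton]
      rw [hne] at hl
      rw [otherEnd_of_isLink hl]
      ring
    · rw [Finset.sum_pair hne, otherEnd_of_isLink hl, otherEnd_of_isLink hl.symm]
      ring
  · intro x e
    simp only [mem_vertices, mem_incEdges, mem_edges, Finset.mem_insert, Finset.mem_singleton]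
    constructor
    · rintro ⟨-, h⟩
      exact ⟨h.eq_or_eq_of_isLink (hst e h.edge_mem), h.edge_mem⟩
    · rintro ⟨h | h, he⟩
      · exact h ▸ ⟨(hst e he).left_mem, (hst e he).inc_left⟩
      · exact h ▸ ⟨(hst e he).right_mem, (hst e he).inc_right⟩

omit [Finite V] [Finite E] in
theorem exists_ends (G : Graph V E) [Nonempty V] :
    ∃ s t : E → V, ∀ e ∈ E(G), G.IsLink e (s e) (t e) := by
  have : ∀ e, ∃ p : V × V, e ∈ E(G) → G.IsLink e p.1 p.2 := by
    intro e
    by_cases he : e ∈ E(G)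
    · obtain ⟨x, y, h⟩ := Graph.exists_isLink_of_mem_edgeSet he
      exact ⟨(x, y), fun _ => h⟩
    · exact ⟨Classical.arbitrary _, fun h => absurd h he⟩
  choose p hp using this
  exact ⟨fun e => (p e).1, fun e => (p e).2, hp⟩

theorem laplacian_expectedHittingTime (G : Graph V E) {u x : V}
    (hfin : ∀ y ∈ V(G), expectedHittingTime G y u ≠ ⊤) (hxu : x ≠ u)
    (hx : (incEdges G x).Nonempty) :
    laplacian G (fun y => (expectedHittingTime G y u).toReal) x = 1 := by
  have h := expectedHittingTime_of_ne G hxu hx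
  have hs : ∀ e ∈ incEdges G x, expectedHittingTime G (otherEnd G e x) u ≠ ⊤ := fun e he =>
    hfin _ (isLink_otherEnd (mem_incEdges.1 he)).right_mem
  have h2 := congrArg ENNReal.toReal h
  rw [ENNReal.toReal_mul, ENNReal.toReal_add ENNReal.one_ne_top (ENNReal.sum_ne_top.2 hs),
    ENNReal.toReal_sum hs, ENNReal.toReal_inv, ENNReal.toReal_natCast, ENNReal.toReal_one] at h2
  have hc : ((incEdges G x).card : ℝ) ≠ 0 := by exact_mod_cast hx.card_pos.ne'
  rw [laplacian, Finset.sum_sub_distrib, Finset.sum_const, nsmul_eq_mul, h2,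
    mul_inv_cancel_left₀ hc]
  ring

/-- A graph in which no set of vertices other than the empty and the full one
has an empty boundary. -/
def HasBoundaries (G : Graph V E) : Prop :=
  ∀ A ⊆ V(G), A.Nonempty → edgeBoundary G A = ∅ → A = V(G)

omit [Finite V] [Finite E] in
theorem edgeBoundary_diff (G : Graph V E) {A : Set V} (hA : A ⊆ V(G)) :
    edgeBoundary G (V(G) \ A) = edgeBoundary G A := by
  ext e
  constructor
  · rintro ⟨x, hx, y, ⟨hy, hy2⟩, h⟩
    exact ⟨y, by simpa [hy] using hy2, x, hx, h.symm⟩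
  · rintro ⟨x, hx, y, hy, h⟩
    exact ⟨y, hy, x, ⟨hA hx, by simp [hx]⟩, h.symm⟩

omit [Finite E] in
-- One of `A` and its complement has at most half of the vertices, and both have the same boundary.
theorem Isoperimetric.hasBoundaries {G : Graph V E} {γ δ : ℝ} (hδ : 0 < δ)
    (h : Isoperimetric G γ δ) : HasBoundaries G := by
  have key : ∀ A ⊆ V(G), 2 * A.ncard ≤ V(G).ncard → edgeBoundary G A = ∅ → A = ∅ := by
    intro A hA h2 h0
    by_contra hne
    have hpos : 0 < A.ncard := (Set.ncard_pos).2 (Set.nonempty_iff_ne_empty.2 hne)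
    have := h A hA h2
    rw [h0, Set.ncard_empty, Nat.cast_zero] at this
    have : 0 < δ * (A.ncard : ℝ) ^ γ := by positivity
    linarith
  intro A hA hne h0
  by_cases h2 : 2 * A.ncard ≤ V(G).ncard
  · exact absurd (key A hA h2 h0) hne.ne_empty
  · have h3 := Set.ncard_sdiff_add_ncard_of_subset hA
    have h4 := key (V(G) \ A) Set.sdiff_subset (by omega) (by rw [edgeBoundary_diff G hA, h0])
    exact hA.antisymm (Set.sdiff_eq_empty.1 h4)

omit [Finite V] in
theorem card_incEdges_le (G : Graph V E) (x : V) : (incEdges G x).card ≤ Nat.card E := by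
  have := Fintype.ofFinite E
  rw [Nat.card_eq_fintype_card]
  exact Finset.card_le_univ _

/-- The simple graph of the adjacencies between different vertices. -/
def adjGraph (G : Graph V E) : SimpleGraph V := SimpleGraph.fromRel G.Adj

omit [Finite V] [Finite E] in
theorem adjGraph_adj {G : Graph V E} {x y : V} : (adjGraph G).Adj x y ↔ x ≠ y ∧ G.Adj x y := by
  simp [adjGraph, SimpleGraph.fromRel_adj, G.adj_comm y x]

omit [Finite V] [Finite E] in
-- The component of `u` has empty boundary.
theorem HasBoundaries.reachable {G : Graph V E} (hG : HasBoundaries G) {u x : V}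
    (hu : u ∈ V(G)) (hx : x ∈ V(G)) : (adjGraph G).Reachable u x := by
  let A : Set V := {y | y ∈ V(G) ∧ (adjGraph G).Reachable u y}
  have hA : A = V(G) := by
    refine hG A (fun y hy => hy.1) ⟨u, hu, .refl _⟩ ?_
    rw [Set.eq_empty_iff_forall_notMem]
    rintro e ⟨y, ⟨hy, hr⟩, z, ⟨hz, hzA⟩, h⟩
    refine hzA ⟨hz, ?_⟩
    by_cases hyz : y = z
    · exact hyz ▸ hr
    · exact hr.trans (adjGraph_adj.2 ⟨hyz, h.adj⟩).reachable
  have : x ∈ A := hA ▸ hx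
  exact this.2

omit [Finite V] [Finite E] in
theorem exists_isLink_dist {G : Graph V E} {u x : V} (hr : (adjGraph G).Reachable u x)
    (hxu : x ≠ u) :
    ∃ e y, G.IsLink e x y ∧ (adjGraph G).dist u x = (adjGraph G).dist u y + 1 := by
  obtain ⟨p, hp⟩ := hr.symm.exists_walk_length_eq_dist
  cases p with
  | nil => exact absurd rfl hxu
  | cons hadj q =>
    rename_i y
    obtain ⟨e, he⟩ := (adjGraph_adj.1 hadj).2
    refine ⟨e, y, he, ?_⟩
    have h1 := (adjGraph G).dist_le q
    rw [SimpleGraph.Walk.length_cons] at hp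
    have h2 := hadj.diff_dist_adj (u := u)
    rw [SimpleGraph.dist_comm (u := u) (v := x), SimpleGraph.dist_comm (u := u) (v := y)] at *
    omega

omit [Finite V] in
-- The barrier is `1 - b ^ dist`. At distance `k`, an edge towards `u` contributes `b ^ (k - 1) - b
-- ^ k` and any other edge at least `-b ^ k`; the choice `b = 1 / (|E| + 1)` lets the first one win.
theorem HasBoundaries.exists_laplacian_pos {G : Graph V E} (hG : HasBoundaries G) {u : V}
    (hu : u ∈ V(G)) :
    ∃ g : V → ℝ, (∀ x, 0 ≤ g x) ∧ ∀ x ∈ V(G), x ≠ u → 0 < laplacian G g x := by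
  classical
  let b : ℝ := ((Nat.card E : ℝ) + 1)⁻¹
  have hb0 : 0 < b := by positivity
  have hbE : ((Nat.card E : ℝ) + 1) * b = 1 := mul_inv_cancel₀ (by positivity)
  have hb1 : b ≤ 1 := inv_le_one_of_one_le₀ (by linarith [(Nat.card E).cast_nonneg (α := ℝ)])
  let D : V → ℕ := fun x => (adjGraph G).dist u x
  refine ⟨fun x => 1 - b ^ D x, fun x => sub_nonneg.2 (pow_le_one₀ hb0.le hb1), ?_⟩
  intro x hx hxu
  obtain ⟨e₀, y, hy, hd⟩ := exists_isLink_dist (hG.reachable hu hx) hxu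
  have he₀ : e₀ ∈ incEdges G x := mem_incEdges.2 hy.inc_left
  have hE : 1 ≤ Nat.card E := Finset.card_pos.2 ⟨e₀, he₀⟩ |>.trans_le (card_incEdges_le G x)
  have hE' : (1 : ℝ) ≤ Nat.card E := by exact_mod_cast hE
  have hb2 : b < 1 := by nlinarith
  rw [laplacian, ← Finset.add_sum_erase _ _ he₀, otherEnd_of_isLink hy]
  have h1 : ∀ e ∈ (incEdges G x).erase e₀,
      -(b ^ D x) ≤ (1 - b ^ D x) - (1 - b ^ D (otherEnd G e x)) := by
    intro e _
    have : 0 < b ^ D (otherEnd G e x) := by positivity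
    linarith
  have h2 := Finset.card_nsmul_le_sum _ _ _ h1
  have h3 : ((incEdges G x).erase e₀).card + 1 ≤ Nat.card E := by
    rw [Finset.card_erase_add_one he₀]
    exact card_incEdges_le G x
  have h3' : (((incEdges G x).erase e₀).card : ℝ) + 1 ≤ Nat.card E := by exact_mod_cast h3
  rw [nsmul_eq_mul] at h2
  have h4 : b ^ D x = b * b ^ D y := by
    simp only [D, hd, pow_succ]
    ring
  have h5 : 0 < b ^ D y := by positivity
  have h6 : 0 < b ^ D x := by positivity
  have h7 : (Nat.card E : ℝ) * b ^ D x < b ^ D y := by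
    rw [h4, ← mul_assoc]
    exact mul_lt_of_lt_one_left h5 (by linarith)
  nlinarith

omit [Finite V] in
theorem HasBoundaries.incEdges_nonempty {G : Graph V E} (hG : HasBoundaries G) {u x : V}
    (hu : u ∈ V(G)) (hx : x ∈ V(G)) (hxu : x ≠ u) : (incEdges G x).Nonempty := by
  obtain ⟨e, y, h, -⟩ := exists_isLink_dist (hG.reachable hu hx) hxu
  exact ⟨e, mem_incEdges.2 h.inc_left⟩

theorem HasBoundaries.expectedHittingTime_ne_top {G : Graph V E} (hG : HasBoundaries G)
    {u v : V} (hu : u ∈ V(G)) (hv : v ∈ V(G)) : expectedHittingTime G v u ≠ ⊤ := by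
  obtain ⟨g, hg0, hg⟩ := hG.exists_laplacian_pos hu
  -- By finiteness, a large multiple of the barrier is a supersolution.
  obtain ⟨C, hC0, hC⟩ : ∃ C : ℝ, 0 ≤ C ∧ ∀ x ∈ V(G), x ≠ u →
      1 + (incEdges G x).card ≤ C * laplacian G g x := by
    obtain ⟨C, hC⟩ := (Set.toFinite (Set.range fun x =>
      (1 + (incEdges G x).card : ℝ) / laplacian G g x)).bddAbove
    refine ⟨max C 0, le_max_right _ _, fun x hx hxu => ?_⟩
    rw [← div_le_iff₀ (hg x hx hxu)]
    exact (hC ⟨x, rfl⟩).trans (le_max_left _ _)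
  refine ne_top_of_le_ne_top ENNReal.ofReal_ne_top
    (expectedHittingTime_le_of_supersolution G u (fun x => ENNReal.ofReal (C * g x))
      (fun x hx hxu => hG.incEdges_nonempty hu hx hxu) ?_ hv)
  intro x hx hxu
  have h := hC x hx hxu
  rw [laplacian, Finset.sum_sub_distrib, Finset.sum_const, nsmul_eq_mul, mul_sub,
    Finset.mul_sum] at h
  rw [← ENNReal.ofReal_sum_of_nonneg fun e _ => mul_nonneg hC0 (hg0 _), ← ENNReal.ofReal_one,
    ← ENNReal.ofReal_natCast, ← ENNReal.ofReal_add zero_le_one (Nat.cast_nonneg _),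
    ← ENNReal.ofReal_add (by positivity)
      (Finset.sum_nonneg fun e _ => mul_nonneg hC0 (hg0 _)),
    ← ENNReal.ofReal_mul (Nat.cast_nonneg _)]
  refine ENNReal.ofReal_le_ofReal ?_
  linarith

end Finite

end

/-! ### Cuts of a potential on a line. -/

section Cuts

variable {E : Type w}

/-- The distance, in vertices, from the cut behind the `j`-th of `N + 1` vertices to the ends. -/
def cutSize (N j : ℕ) : ℕ := min (j + 1) (N - j)

/-- The edges over the cut behind the `j`-th vertex. -/
def cutEdges (T : Finset E) (lo hi : E → ℕ) (j : ℕ) : Finset E :=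
  T.filter fun e => lo e ≤ j ∧ j < hi e

/-- An edge over cut `j` but not over cut `i` has an end at one of the at most `r` positions between
them. -/
theorem card_cutEdges_le [DecidableEq E] (T : Finset E) (lo hi : E → ℕ) {D : ℕ}
    (hD : ∀ k, (T.filter fun e => lo e = k ∨ hi e = k).card ≤ D) (i j : ℕ) {r : ℕ}
    (h1 : i ≤ j + r) (h2 : j ≤ i + r) :
    (cutEdges T lo hi j).card ≤ (cutEdges T lo hi i ∩ cutEdges T lo hi j).card + r * D := by
  have hsub : cutEdges T lo hi j ⊆ (cutEdges T lo hi i ∩ cutEdges T lo hi j) ∪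
      (Finset.Ioc (min i j) (max i j)).biUnion
        fun k => T.filter fun e => lo e = k ∨ hi e = k := by
    intro e he
    simp only [cutEdges, Finset.mem_union, Finset.mem_inter, Finset.mem_filter,
      Finset.mem_biUnion, Finset.mem_Ioc] at he ⊢
    by_cases hi' : lo e ≤ i ∧ i < hi e
    · exact Or.inl ⟨⟨he.1, hi'⟩, he⟩
    · right
      by_cases h : lo e ≤ i
      · exact ⟨hi e, by omega, he.1, Or.inr rfl⟩
      · exact ⟨lo e, by omega, he.1, Or.inl rfl⟩
  refine (Finset.card_le_card hsub).trans ((Finset.card_union_le _ _).trans ?_)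
  gcongr
  refine (Finset.card_biUnion_le_card_mul _ _ D fun k _ => hD k).trans ?_
  rw [Nat.card_Ioc]
  gcongr
  omega

theorem sum_Ico_sub_succ (H : ℕ → ℝ) {a b : ℕ} (h : a ≤ b) :
    ∑ j ∈ Finset.Ico a b, (H (j + 1) - H j) = H b - H a := by
  induction b, h using Nat.le_induction with
  | base => simp
  | succ b hb ih => rw [Finset.sum_Ico_succ_top hb, ih]; ring

theorem sum_rpow_cutSize_le {p : ℝ} (hp : p < -1) (N : ℕ) :
    ∑ j ∈ Finset.range N, (cutSize N j : ℝ) ^ p ≤ 2 * ∑' k : ℕ, ((k + 1 : ℕ) : ℝ) ^ p := by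
  have hs : Summable fun k : ℕ => ((k + 1 : ℕ) : ℝ) ^ p :=
    (summable_nat_add_iff 1).2 (Real.summable_nat_rpow.2 hp)
  have h1 : ∑ j ∈ Finset.range N, ((j + 1 : ℕ) : ℝ) ^ p ≤ ∑' k : ℕ, ((k + 1 : ℕ) : ℝ) ^ p :=
    hs.sum_le_tsum _ fun k _ => by positivity
  have h2 := Finset.sum_range_reflect (fun j => ((j + 1 : ℕ) : ℝ) ^ p) N
  have h3 : ∑ j ∈ Finset.range N, (cutSize N j : ℝ) ^ p ≤
      ∑ j ∈ Finset.range N, (((j + 1 : ℕ) : ℝ) ^ p + ((N - 1 - j + 1 : ℕ) : ℝ) ^ p) := by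
    refine Finset.sum_le_sum fun j hj => ?_
    have hj' := Finset.mem_range.1 hj
    have h4 : 0 ≤ ((j + 1 : ℕ) : ℝ) ^ p := by positivity
    have h5 : 0 ≤ ((N - 1 - j + 1 : ℕ) : ℝ) ^ p := by positivity
    rcases le_total (j + 1) (N - j) with h | h
    · rw [cutSize, min_eq_left h]
      linarith
    · rw [cutSize, min_eq_right h, show N - j = N - 1 - j + 1 by omega]
      linarith
  rw [Finset.sum_add_distrib, h2] at h3
  linarith

/-- Many cuts near the `j`-th one are not larger and share half of its edges. -/
theorem exists_near_cuts {γ δ D : ℝ} (hγ : γ < 1) (hδ : 0 < δ) (hD : 0 < D)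
    {N j : ℕ} (hj : j < N) :
    ∃ (r : ℕ) (I : Finset ℕ), I ⊆ Finset.range N ∧
      (∀ i ∈ I, i ≤ j + r ∧ j ≤ i + r ∧ cutSize N i ≤ cutSize N j) ∧
      r * D ≤ δ * (cutSize N j : ℝ) ^ γ / 2 ∧
      min 1 (δ / (2 * D)) * (cutSize N j : ℝ) ^ γ ≤ I.card := by
  set m := cutSize N j with hm
  have hm1 : 1 ≤ m := by rw [hm, cutSize]; omega
  have hm1' : (1 : ℝ) ≤ m := by exact_mod_cast hm1
  set a := δ / (2 * D) with ha
  have ha0 : 0 < a := by positivity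
  have hmγ : 0 < (m : ℝ) ^ γ := by positivity
  -- `q` is the number of cuts taken, `j` included, so distances are at most `q - 1`. The value of
  -- `a` makes `(q - 1) * D` at most half of `δ * m ^ γ`; the bound by `m` keeps the cuts on the
  -- line, and costs nothing in order since `m ^ γ ≤ m`.
  set q := min m ⌈a * (m : ℝ) ^ γ⌉₊ with hq
  have hq1 : 1 ≤ q := le_min hm1 (Nat.one_le_ceil_iff.2 (by positivity))
  have hqr : ((q - 1 : ℕ) : ℝ) * D ≤ δ * (m : ℝ) ^ γ / 2 := by
    have h1 : ((q - 1 : ℕ) : ℝ) ≤ a * (m : ℝ) ^ γ := by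
      have h2 : q - 1 < ⌈a * (m : ℝ) ^ γ⌉₊ := by
        have := min_le_right m ⌈a * (m : ℝ) ^ γ⌉₊
        omega
      exact (Nat.lt_ceil.1 h2).le
    calc ((q - 1 : ℕ) : ℝ) * D ≤ a * (m : ℝ) ^ γ * D := by gcongr
      _ = δ * (m : ℝ) ^ γ / 2 := by rw [ha]; field_simp
  have hqc : min 1 a * (m : ℝ) ^ γ ≤ q := by
    rw [hq, Nat.cast_min]
    refine le_min ?_ ?_
    · calc min 1 a * (m : ℝ) ^ γ ≤ 1 * (m : ℝ) ^ (1 : ℝ) := by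
            gcongr
            · exact min_le_left _ _
        _ = m := by simp
    · calc min 1 a * (m : ℝ) ^ γ ≤ a * (m : ℝ) ^ γ := by
            gcongr
            exact min_le_right _ _
        _ ≤ _ := Nat.le_ceil _
  have hqm : q ≤ m := min_le_left _ _
  clear_value q m
  -- The cuts are taken towards the nearer end, where sizes do not increase.
  rcases le_total (j + 1) (N - j) with h | h
  · rw [cutSize, min_eq_left h] at hm
    refine ⟨q - 1, Finset.Ico (j + 1 - q) (j + 1), ?_, ?_, hqr, ?_⟩
    · intro i
      simp only [Finset.mem_Ico, Finset.mem_range]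
      omega
    · intro i
      simp only [Finset.mem_Ico, cutSize]
      omega
    · rwa [Nat.card_Ico, show j + 1 - (j + 1 - q) = q by omega]
  · rw [cutSize, min_eq_right h] at hm
    refine ⟨q - 1, Finset.Ico j (j + q), ?_, ?_, hqr, ?_⟩
    · intro i
      simp only [Finset.mem_Ico, Finset.mem_range]
      omega
    · intro i
      simp only [Finset.mem_Ico, cutSize]
      omega
    · rwa [Nat.card_Ico, show j + q - j = q by omega]

/-- If every cut of a potential on a line carries little flow, the potential drop is small. -/
theorem potential_drop_le {γ δ : ℝ} {D : ℕ} (hγ2 : 1 / 2 < γ) (hγ : γ < 1) (hδ : 0 < δ)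
    (hD : 0 < D) {N : ℕ} {H : ℕ → ℝ} (hH : Monotone H) (T : Finset E) {lo hi : E → ℕ}
    (hle : ∀ e ∈ T, lo e ≤ hi e) (hN : ∀ e ∈ T, hi e ≤ N)
    (hdeg : ∀ k, (T.filter fun e => lo e = k ∨ hi e = k).card ≤ D) {F : ℝ}
    (hflow : ∀ j < N, ∑ e ∈ cutEdges T lo hi j, (H (hi e) - H (lo e)) ≤ F)
    (hiso : ∀ j < N, δ * (cutSize N j : ℝ) ^ γ ≤ (cutEdges T lo hi j).card) (hF : 0 ≤ F) :
    (min 1 (δ / (2 * D)) * δ / 2) * (H N - H 0) ≤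
      2 * (∑' k : ℕ, ((k + 1 : ℕ) : ℝ) ^ (-2 * γ)) * F := by
  classical
  let w : ℕ → ℝ := fun i => (cutSize N i : ℝ) ^ (-2 * γ)
  have hw0 : ∀ i, 0 ≤ w i := fun i => by positivity
  let C := cutEdges T lo hi
  have hD' : (0 : ℝ) < D := by exact_mod_cast hD
  -- With `m` the size of cut `j`, of order `m ^ γ` nearby cuts each contribute at least `m ^ (-2γ)
  -- * (δ * m ^ γ / 2)`, and the powers of `m` cancel.
  have hκ : ∀ j ∈ Finset.range N, min 1 (δ / (2 * D)) * δ / 2 ≤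
      ∑ i ∈ Finset.range N, w i * ((C i ∩ C j).card : ℝ) := by
    intro j hj
    have hj' := Finset.mem_range.1 hj
    obtain ⟨r, I, hI, hI2, hr, hc⟩ := exists_near_cuts hγ hδ hD' hj'
    have hm1 : 1 ≤ cutSize N j := by rw [cutSize]; omega
    have hm0 : (0 : ℝ) < cutSize N j := by exact_mod_cast hm1
    have h1 : ∀ i ∈ I, (cutSize N j : ℝ) ^ (-2 * γ) * (δ * (cutSize N j : ℝ) ^ γ / 2) ≤
        w i * ((C i ∩ C j).card : ℝ) := by
      intro i hi'
      obtain ⟨ha, hb, hcs⟩ := hI2 i hi'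
      have hi1 : 1 ≤ cutSize N i := by
        have := Finset.mem_range.1 (hI hi')
        rw [cutSize]; omega
      refine mul_le_mul ?_ ?_ (by positivity) (hw0 i)
      · exact Real.rpow_le_rpow_of_nonpos (by exact_mod_cast hi1) (by exact_mod_cast hcs)
          (by linarith)
      · have h2 := card_cutEdges_le T lo hi hdeg i j ha hb
        have h3 : ((C j).card : ℝ) ≤ (C i ∩ C j).card + r * D := by exact_mod_cast h2
        have h4 := hiso j hj'
        simp only [C] at h3 ⊢
        linarith
    have h2 : (cutSize N j : ℝ) ^ (-2 * γ) * ((cutSize N j : ℝ) ^ γ * (cutSize N j : ℝ) ^ γ) = 1 := by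
      rw [← Real.rpow_add hm0, ← Real.rpow_add hm0]
      ring_nf
      simp
    calc min 1 (δ / (2 * D)) * δ / 2
        = min 1 (δ / (2 * D)) * (cutSize N j : ℝ) ^ γ *
          ((cutSize N j : ℝ) ^ (-2 * γ) * (δ * (cutSize N j : ℝ) ^ γ / 2)) := by
          linear_combination -(min 1 (δ / (2 * D)) * δ / 2) * h2
      _ ≤ I.card * ((cutSize N j : ℝ) ^ (-2 * γ) * (δ * (cutSize N j : ℝ) ^ γ / 2)) := by
          gcongr
      _ ≤ ∑ i ∈ I, w i * ((C i ∩ C j).card : ℝ) := by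
          rw [← nsmul_eq_mul]
          exact Finset.card_nsmul_le_sum _ _ _ h1
      _ ≤ _ := Finset.sum_le_sum_of_subset_of_nonneg hI fun i _ _ =>
          mul_nonneg (hw0 i) (Nat.cast_nonneg _)
  have hdrop : ∀ e ∈ T, H (hi e) - H (lo e) =
      ∑ j ∈ Finset.range N, if e ∈ C j then H (j + 1) - H j else 0 := by
    intro e he
    rw [← sum_Ico_sub_succ H (hle e he), ← Finset.sum_filter]
    congr 1
    ext j
    have := hN e he
    simp only [C, cutEdges, Finset.mem_filter, Finset.mem_range, Finset.mem_Ico, he, true_and]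
    omega
  -- The flow over cut `i`, sorted by the gaps over which its edges drop.
  have hswap : ∀ i, ∑ e ∈ C i, (H (hi e) - H (lo e)) =
      ∑ j ∈ Finset.range N, ((C i ∩ C j).card : ℝ) * (H (j + 1) - H j) := by
    intro i
    have hT : ∀ e ∈ C i, e ∈ T := fun e he => (Finset.mem_filter.1 he).1
    rw [Finset.sum_congr rfl fun e he => hdrop e (hT e he), Finset.sum_comm]
    refine Finset.sum_congr rfl fun j _ => ?_
    rw [← Finset.sum_filter, Finset.sum_const, nsmul_eq_mul, Finset.filter_mem_eq_inter]
  calc (min 1 (δ / (2 * D)) * δ / 2) * (H N - H 0)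
      = ∑ j ∈ Finset.range N, (min 1 (δ / (2 * D)) * δ / 2) * (H (j + 1) - H j) := by
        rw [← Finset.mul_sum, Finset.sum_range_sub]
    _ ≤ ∑ j ∈ Finset.range N, (∑ i ∈ Finset.range N, w i * ((C i ∩ C j).card : ℝ)) *
          (H (j + 1) - H j) := by
        refine Finset.sum_le_sum fun j hj => ?_
        exact mul_le_mul_of_nonneg_right (hκ j hj) (sub_nonneg.2 (hH (Nat.le_succ j)))
    _ = ∑ i ∈ Finset.range N, w i * ∑ e ∈ C i, (H (hi e) - H (lo e)) := by
        simp_rw [hswap, Finset.sum_mul, Finset.mul_sum]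
        rw [Finset.sum_comm]
        simp_rw [mul_assoc]
    _ ≤ ∑ i ∈ Finset.range N, w i * F := by
        refine Finset.sum_le_sum fun i hi' => ?_
        exact mul_le_mul_of_nonneg_left (hflow i (Finset.mem_range.1 hi')) (hw0 i)
    _ = (∑ i ∈ Finset.range N, w i) * F := by rw [Finset.sum_mul]
    _ ≤ _ := by
        gcongr
        exact sum_rpow_cutSize_le (by linarith) N

end Cuts

/-! ### The linear upper bound for bounded degree. -/

section

variable {V : Type u} {E : Type w} [Finite V] [Finite E]

omit [Finite E] in
/-- The vertices can be enumerated by increasing values of a potential. -/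
theorem exists_sorted_enumeration (G : Graph V E) (h : V → ℝ) (hne : 0 < V(G).ncard) :
    ∃ (pos : V → ℕ) (H : ℕ → ℝ), Monotone H ∧ Set.InjOn pos V(G) ∧
      ∀ x ∈ V(G), pos x < V(G).ncard ∧ H (pos x) = h x := by
  classical
  set n := V(G).ncard with hn
  let f : Fin n ≃ vertices G := (finCongr (by rw [hn, card_vertices])).trans (vertices G).equivFin.symm
  let τ : Equiv.Perm (Fin n) := Tuple.sort fun i => h (f i)
  have hτ : Monotone fun i => h (f (τ i)) := Tuple.monotone_sort fun i => h (f i)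
  let σ : Fin n ≃ vertices G := τ.trans f
  let pos : V → ℕ := fun x => if hx : x ∈ vertices G then (σ.symm ⟨x, hx⟩ : ℕ) else 0
  -- Clamping the index extends the sorted values by a constant, so that `H` is monotone on all of
  -- `ℕ`.
  refine ⟨pos, fun k => h (σ ⟨min k (n - 1), by omega⟩), ?_, ?_, ?_⟩
  · intro a b hab
    exact hτ (by simpa using min_le_min_right (n - 1) hab)
  · intro x hx y hy hxy
    simp only [pos, mem_vertices.2 hx, mem_vertices.2 hy, dite_true] at hxy
    simpa using σ.symm.injective (Fin.ext hxy)
  · intro x hx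
    have hx' := mem_vertices.2 hx
    have hp : pos x = (σ.symm ⟨x, hx'⟩ : ℕ) := by simp only [pos, hx', dite_true]
    have hlt : pos x < n := hp ▸ (σ.symm ⟨x, hx'⟩).2
    refine ⟨hlt, ?_⟩
    have : (⟨min (pos x) (n - 1), by omega⟩ : Fin n) = σ.symm ⟨x, hx'⟩ := by
      apply Fin.ext
      simp only [hp]
      omega
    simp only [this, Equiv.apply_symm_apply]

omit [Finite E] in
theorem image_vertices_eq_range [DecidableEq V] (G : Graph V E) {pos : V → ℕ}
    (hinj : Set.InjOn pos V(G)) (hlt : ∀ x ∈ V(G), pos x < V(G).ncard) :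
    (vertices G).image pos = Finset.range V(G).ncard := by
  refine Finset.eq_of_subset_of_card_le ?_ ?_
  · intro k hk
    obtain ⟨x, hx, rfl⟩ := Finset.mem_image.1 hk
    exact Finset.mem_range.2 (hlt x (mem_vertices.1 hx))
  · rw [Finset.card_image_of_injOn fun x hx y hy => hinj (by simpa using hx) (by simpa using hy),
      card_vertices, Finset.card_range]

omit [Finite E] in
theorem ncard_initial (G : Graph V E) {pos : V → ℕ} (hinj : Set.InjOn pos V(G))
    (hlt : ∀ x ∈ V(G), pos x < V(G).ncard) {j : ℕ} (hj : j < V(G).ncard) :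
    {x | x ∈ V(G) ∧ pos x ≤ j}.ncard = j + 1 := by
  classical
  have h : pos '' {x | x ∈ V(G) ∧ pos x ≤ j} = (Finset.range (j + 1) : Set ℕ) := by
    ext k
    simp only [Set.mem_image, Set.mem_ofPred_eq, Finset.coe_range, Set.mem_Iio]
    constructor
    · rintro ⟨x, ⟨-, hx⟩, rfl⟩
      omega
    · intro hk
      have : k ∈ (vertices G).image pos := by
        rw [image_vertices_eq_range G hinj hlt, Finset.mem_range]
        omega
      obtain ⟨x, hx, rfl⟩ := Finset.mem_image.1 this
      exact ⟨x, ⟨mem_vertices.1 hx, by omega⟩, rfl⟩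
  rw [← (hinj.mono fun x hx => hx.1).ncard_image, h, Set.ncard_coe_finset,
    Finset.card_range]

/-- In a graph of bounded degree with an isoperimetric inequality, a nonnegative potential that
vanishes at one vertex and whose Laplacian is at most `1` at the others is at most linear. -/
theorem potential_le {γ δ : ℝ} {D : ℕ} (hγ2 : 1 / 2 < γ) (hγ : γ < 1) (hδ : 0 < δ)
    (hD : 0 < D) {G : Graph V E} (hdeg : ∀ x ∈ V(G), (incEdges G x).card ≤ D)
    (hiso : Isoperimetric G γ δ) {h : V → ℝ} (h0 : ∀ x, 0 ≤ h x) {u : V} (hu : u ∈ V(G))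
    (hu0 : h u = 0) (hL : ∀ x ∈ V(G), x ≠ u → laplacian G h x ≤ 1) {v : V} (hv : v ∈ V(G)) :
    (min 1 (δ / (2 * D)) * δ / 2) * h v ≤
      2 * (∑' k : ℕ, ((k + 1 : ℕ) : ℝ) ^ (-2 * γ)) * V(G).ncard := by
  classical
  have : Nonempty V := ⟨u⟩
  have hn : 0 < V(G).ncard := (Set.ncard_pos).2 ⟨u, hu⟩
  obtain ⟨s, t, hst⟩ := exists_ends G
  obtain ⟨pos, H, hH, hinj, hpos⟩ := exists_sorted_enumeration G h hn
  have hlt := fun x hx => (hpos x hx).1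
  let lo : E → ℕ := fun e => min (pos (s e)) (pos (t e))
  let hi : E → ℕ := fun e => max (pos (s e)) (pos (t e))
  have hbd : ∀ (A : Set V) (j : ℕ), A = {x | x ∈ V(G) ∧ pos x ≤ j} →
      edgeBoundary G A = (cutEdges (edges G) lo hi j : Set E) := by
    rintro A j rfl
    ext e
    simp only [edgeBoundary, cutEdges, Finset.coe_filter, mem_edges, Set.mem_ofPred_eq,
      Set.mem_sdiff, lo, hi]
    constructor
    · rintro ⟨x, ⟨-, hxj⟩, y, ⟨hy, hyj⟩, hl⟩
      have hyj' : j < pos y := by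
        by_contra hcon
        exact hyj ⟨hy, by omega⟩
      refine ⟨hl.edge_mem, ?_⟩
      rcases (hst e hl.edge_mem).eq_and_eq_or_eq_and_eq hl with ⟨h1, h2⟩ | ⟨h1, h2⟩ <;>
        rw [h1, h2] <;> omega
    · rintro ⟨he, h1, h2⟩
      have hl := hst e he
      rcases le_or_gt (pos (s e)) j with h3 | h3
      · exact ⟨s e, ⟨hl.left_mem, h3⟩, t e, ⟨hl.right_mem, fun h4 => by omega⟩, hl⟩
      · exact ⟨t e, ⟨hl.right_mem, by omega⟩, s e, ⟨hl.left_mem, fun h4 => by omega⟩, hl.symm⟩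
  have key := potential_drop_le (N := V(G).ncard - 1) (lo := lo) (hi := hi)
    (F := V(G).ncard) hγ2 hγ hδ hD hH (edges G) ?_ ?_ ?_ ?_ ?_ (Nat.cast_nonneg _)
  · refine le_trans ?_ key
    have h1 : h v ≤ H (V(G).ncard - 1) := by
      rw [← (hpos v hv).2]
      have := hlt v hv
      exact hH (by omega)
    have h2 : H 0 ≤ 0 := by
      rw [← hu0, ← (hpos u hu).2]
      exact hH (Nat.zero_le _)
    gcongr
    linarith
  · exact fun e _ => min_le_max
  · intro e he
    have hl := hst e (mem_edges.1 he)
    have h1 := hlt _ hl.left_mem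
    have h2 := hlt _ hl.right_mem
    simp only [hi]
    omega
  · intro k
    by_cases hk : ∃ x ∈ V(G), pos x = k
    · obtain ⟨x, hx, rfl⟩ := hk
      refine (Finset.card_le_card ?_).trans (hdeg x hx)
      intro e he
      simp only [Finset.mem_filter, mem_edges, lo, hi] at he
      have hl := hst e he.1
      rw [mem_incEdges]
      have : pos (s e) = pos x ∨ pos (t e) = pos x := by omega
      rcases this with h1 | h1
      · exact hinj hl.left_mem hx h1 ▸ hl.inc_left
      · exact hinj hl.right_mem hx h1 ▸ hl.inc_right
    · rw [Finset.filter_eq_empty_iff.2]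
      · simp
      · intro e he hcon
        have hl := hst e (mem_edges.1 he)
        simp only [lo, hi] at hcon
        have : pos (s e) = k ∨ pos (t e) = k := by omega
        rcases this with h1 | h1
        · exact hk ⟨_, hl.left_mem, h1⟩
        · exact hk ⟨_, hl.right_mem, h1⟩
  · intro j _
    -- The indicator of the upper side turns Green's identity into the flow over the cut. The
    -- Laplacian is at most `1` at `u` as well, since `h` has its minimum `0` there.
    have hgreen := sum_mul_laplacian G hst (fun x => if j < pos x then 1 else 0) h
    have h1 : ∑ x ∈ vertices G, (if j < pos x then (1 : ℝ) else 0) * laplacian G h x ≤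
        V(G).ncard := by
      rw [← card_vertices, ← nsmul_one]
      refine Finset.sum_le_card_nsmul _ _ _ fun x hx => ?_
      have hx1 : laplacian G h x ≤ 1 := by
        by_cases hxu : x = u
        · rw [laplacian]
          refine (Finset.sum_nonpos fun e _ => ?_).trans zero_le_one
          rw [hxu, hu0]
          linarith [h0 (otherEnd G e u)]
        · exact hL x (mem_vertices.1 hx) hxu
      split_ifs <;> linarith
    rw [hgreen] at h1
    refine le_trans (le_of_eq ?_) h1
    rw [cutEdges, Finset.sum_filter]
    refine Finset.sum_congr rfl fun e he => ?_
    have hl := hst e (mem_edges.1 he)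
    rw [← (hpos _ hl.left_mem).2, ← (hpos _ hl.right_mem).2]
    simp only [lo, hi]
    rcases le_total (pos (s e)) (pos (t e)) with h2 | h2
    · rw [min_eq_left h2, max_eq_right h2]
      split_ifs <;> first | omega | ring
    · rw [min_eq_right h2, max_eq_left h2]
      split_ifs <;> first | omega | ring
  · intro j hj
    have hcard := ncard_initial G hinj hlt (j := j) (by omega)
    have hb := hbd _ j rfl
    have hsub : {x | x ∈ V(G) ∧ pos x ≤ j} ⊆ V(G) := fun x hx => hx.1
    have hcc := Set.ncard_sdiff_add_ncard_of_subset hsub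
    -- The isoperimetric inequality is applied to the smaller side of the cut.
    rcases le_total (j + 1) (V(G).ncard - 1 - j) with h2 | h2
    · have := hiso _ hsub (by omega)
      rw [hb, hcard, Set.ncard_coe_finset] at this
      rwa [cutSize, min_eq_left h2]
    · have := hiso _ (Set.sdiff_subset (s := V(G)) (t := {x | x ∈ V(G) ∧ pos x ≤ j})) (by omega)
      rw [edgeBoundary_diff G hsub, hb, Set.ncard_coe_finset] at this
      rwa [cutSize, min_eq_right h2, show V(G).ncard - 1 - j =
        (V(G) \ {x | x ∈ V(G) ∧ pos x ≤ j}).ncard by omega]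

omit [Finite V] in
-- Only an inequality: a loop carries one clock but counts twice in the degree.
theorem IsRegular.card_incEdges_le {G : Graph V E} {d : ℕ} (hG : IsRegular G d) {x : V}
    (hx : x ∈ V(G)) : (incEdges G x).card ≤ d := by
  have h : (incEdges G x).card = {e | G.Inc e x}.ncard :=
    (Set.ncard_eq_toFinset_card _ _).symm
  rw [← hG x hx, degree, h]
  exact Nat.le_add_right _ _

/-- Regular graphs of bounded degree with an isoperimetric inequality of exponent above `1 / 2`
have at most linear mean commute times. -/
theorem maxCommuteTime_le {γ δ : ℝ} (D : ℕ) (hγ2 : 1 / 2 < γ) (hγ : γ < 1) (hδ : 0 < δ) :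
    ∃ K : ℝ, 0 < K ∧
      ∀ (V : Type u) (E : Type w) [Finite V] [Finite E] (G : Graph V E) (d : ℕ),
        d ≤ D → IsRegular G d → Isoperimetric G γ δ →
          maxCommuteTime G ≤ ENNReal.ofReal (K * (V(G).ncard : ℝ)) := by
  -- `D + 1` replaces `D` because the cut estimate needs a positive degree bound.
  set κ : ℝ := min 1 (δ / (2 * (D + 1 : ℕ))) * δ / 2
  set Z : ℝ := ∑' k : ℕ, ((k + 1 : ℕ) : ℝ) ^ (-2 * γ)
  have hκ : 0 < κ := by positivity
  have hZ : 0 ≤ Z := tsum_nonneg fun k => by positivity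
  refine ⟨4 * Z / κ + 1, by positivity, ?_⟩
  intro V E _ _ G d hd hreg hiso
  have hb := hiso.hasBoundaries hδ
  have key : ∀ v ∈ V(G), ∀ u ∈ V(G), expectedHittingTime G v u ≤
      ENNReal.ofReal (2 * Z / κ * (V(G).ncard : ℝ)) := by
    intro v hv u hu
    have hfin : ∀ y ∈ V(G), expectedHittingTime G y u ≠ ⊤ := fun y hy =>
      hb.expectedHittingTime_ne_top hu hy
    have h := potential_le hγ2 hγ hδ (Nat.succ_pos D)
      (fun x hx => (hreg.card_incEdges_le hx).trans (by omega)) hiso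
      (h := fun y => (expectedHittingTime G y u).toReal) (fun x => ENNReal.toReal_nonneg) hu
      (by simp [expectedHittingTime_self])
      (fun x hx hxu => (laplacian_expectedHittingTime G hfin hxu
        (hb.incEdges_nonempty hu hx hxu)).le) hv
    rw [← ENNReal.ofReal_toReal (hfin v hv)]
    refine ENNReal.ofReal_le_ofReal ?_
    rw [div_mul_eq_mul_div, le_div_iff₀ hκ, mul_comm]
    exact h
  refine iSup₂_le fun v hv => iSup₂_le fun u hu => ?_
  refine (add_le_add (key v hv u hu) (key u hu v hv)).trans ?_
  rw [← ENNReal.ofReal_add (by positivity) (by positivity)]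
  refine ENNReal.ofReal_le_ofReal ?_
  have : (0 : ℝ) ≤ V(G).ncard := by positivity
  have e : 4 * Z / κ = 2 * Z / κ + 2 * Z / κ := by ring
  rw [e]
  nlinarith

end

/-! ### Lower bounds by test functions. -/

section TestFunction

variable {V : Type u} {E : Type w} [Finite V] [Finite E]

/-- A test function with small energy against all nonnegative functions bounds the maximal mean
commute time from below. -/
theorem le_maxCommuteTime {G : Graph V E} {u : V} (hu : u ∈ V(G))
    (hne : ∀ x ∈ V(G), (incEdges G x).Nonempty) {s t : E → V}
    (hst : ∀ e ∈ E(G), G.IsLink e (s e) (t e)) {φ : V → ℝ} (hφ : φ u = 0) {c : ℝ} (hc : 0 < c)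
    (hφc : ∀ h : V → ℝ, (∀ x, 0 ≤ h x) →
      ∑ e ∈ edges G, (φ (s e) - φ (t e)) * (h (s e) - h (t e)) ≤ c * ∑ x ∈ vertices G, h x) :
    ENNReal.ofReal ((∑ x ∈ vertices G, φ x) / (c * V(G).ncard)) ≤ maxCommuteTime G := by
  by_cases hM : maxCommuteTime G = ⊤
  · simp [hM]
  have hle : ∀ y ∈ V(G), expectedHittingTime G y u ≤ maxCommuteTime G := fun y hy =>
    le_self_add.trans (le_iSup₂_of_le y hy (le_iSup₂ (f := fun z _ =>
      expectedHittingTime G y z + expectedHittingTime G z y) u hu))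
  have hfin : ∀ y ∈ V(G), expectedHittingTime G y u ≠ ⊤ := fun y hy =>
    ne_top_of_le_ne_top hM (hle y hy)
  let h : V → ℝ := fun y => (expectedHittingTime G y u).toReal
  have hgreen := sum_mul_laplacian G hst φ h
  -- The unknown Laplacian of `h` at `u` is killed by `φ u = 0`.
  have h1 : ∑ x ∈ vertices G, φ x * laplacian G h x = ∑ x ∈ vertices G, φ x := by
    refine Finset.sum_congr rfl fun x hx => ?_
    by_cases hxu : x = u
    · simp [hxu, hφ]
    · rw [laplacian_expectedHittingTime G hfin hxu (hne x (mem_vertices.1 hx)), mul_one]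
  have h2 : ∑ x ∈ vertices G, h x ≤ V(G).ncard * (maxCommuteTime G).toReal := by
    rw [← card_vertices, ← nsmul_eq_mul]
    exact Finset.sum_le_card_nsmul _ _ _ fun x hx =>
      ENNReal.toReal_mono hM (hle x (mem_vertices.1 hx))
  have hn : (0 : ℝ) < V(G).ncard := by
    exact_mod_cast (Set.ncard_pos).2 ⟨u, hu⟩
  rw [ENNReal.ofReal_le_iff_le_toReal hM, div_le_iff₀ (by positivity), ← h1, hgreen]
  refine (hφc h fun x => ENNReal.toReal_nonneg).trans ?_
  nlinarith

end TestFunction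

/-! ### The parabola and walks around a cycle. -/

section Cycle

variable {n : ℕ} [NeZero n]

/-- A quadratic test function on the cycle. -/
noncomputable def parabola (n : ℕ) (i : ZMod n) : ℝ := (i.val : ℝ) * (n - i.val)

omit [NeZero n] in
theorem parabola_zero : parabola n 0 = 0 := by simp [parabola]

theorem val_add_one_cases (i : ZMod n) :
    (i + 1).val = i.val + 1 ∨ ((i + 1).val = 0 ∧ i.val + 1 = n) := by
  have h : (i + 1).val = (i.val + 1) % n := by
    rw [ZMod.val_add, ZMod.val_one_eq_one_mod, Nat.add_mod_mod]
  have h2 := ZMod.val_lt i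
  rcases (Nat.succ_le_of_lt h2).lt_or_eq with h3 | h3
  · exact Or.inl (h.trans (Nat.mod_eq_of_lt h3))
  · exact Or.inr ⟨by rw [h, show i.val + 1 = n from h3, Nat.mod_self], h3⟩

theorem parabola_add_one (i : ZMod n) :
    parabola n (i + 1) = ((i.val : ℝ) + 1) * (n - (i.val + 1)) := by
  rcases val_add_one_cases i with h | ⟨h, h2⟩
  · simp [parabola, h]
  · have : (i.val : ℝ) + 1 = n := by exact_mod_cast h2
    rw [parabola, h, this]
    simp

/-- Equality except at `i = 0`, where wrapping around makes the true value larger than the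
polynomial. -/
theorem parabola_sub_one_ge (i : ZMod n) :
    ((i.val : ℝ) - 1) * (n - (i.val - 1)) ≤ parabola n (i - 1) := by
  have h := val_add_one_cases (i - 1)
  rw [sub_add_cancel] at h
  rcases h with h | ⟨h, h2⟩
  · have h3 : (i.val : ℝ) = (i - 1).val + 1 := by exact_mod_cast h
    rw [h3, parabola]
    apply le_of_eq
    ring
  · have h3 : ((i - 1).val : ℝ) + 1 = n := by exact_mod_cast h2
    have h4 : (0 : ℝ) ≤ (i - 1).val := Nat.cast_nonneg _
    rw [h, parabola, ← h3]
    push_cast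
    nlinarith

/-- Summation by parts moves the differences onto the parabola, whose negative second difference is
`2`; the kink at `0` only lowers it. -/
theorem sum_parabola_energy_le {h : ZMod n → ℝ} (h0 : ∀ i, 0 ≤ h i) :
    ∑ i, (parabola n i - parabola n (i + 1)) * (h i - h (i + 1)) ≤ 2 * ∑ i, h i := by
  have h1 : ∑ i, (parabola n i - parabola n (i + 1)) * h (i + 1) =
      ∑ i, (parabola n (i - 1) - parabola n i) * h i := by
    rw [← Equiv.sum_comp (Equiv.addRight (1 : ZMod n))
      fun i => (parabola n (i - 1) - parabola n i) * h i]
    simp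
  calc ∑ i, (parabola n i - parabola n (i + 1)) * (h i - h (i + 1))
      = ∑ i, (2 * parabola n i - parabola n (i + 1) - parabola n (i - 1)) * h i := by
        simp_rw [mul_sub]
        rw [Finset.sum_sub_distrib, h1, ← Finset.sum_sub_distrib]
        exact Finset.sum_congr rfl fun i _ => by ring
    _ ≤ ∑ i, 2 * h i := by
        refine Finset.sum_le_sum fun i _ => mul_le_mul_of_nonneg_right ?_ (h0 i)
        have h2 := parabola_add_one i
        have h3 := parabola_sub_one_ge i
        rw [h2, parabola]
        linarith
    _ = _ := by rw [Finset.mul_sum]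

theorem sum_parabola : ∑ i, parabola n i = ((n : ℝ) ^ 3 - n) / 6 := by
  have h1 : ∑ i, parabola n i = ∑ k ∈ Finset.range n, (k : ℝ) * (n - k) := by
    obtain ⟨k, rfl⟩ := Nat.exists_eq_succ_of_ne_zero (NeZero.ne n)
    exact Fin.sum_univ_eq_sum_range (fun j => (j : ℝ) * ((k + 1 : ℕ) - j)) (k + 1)
  have h2 : ∀ m : ℕ, ∑ k ∈ Finset.range m, (k : ℝ) * (n - k) =
      n * (m * (m - 1) / 2) - (m - 1) * m * (2 * m - 1) / 6 := by
    intro m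
    induction m with
    | zero => simp
    | succ m ih => rw [Finset.sum_range_succ, ih]; push_cast; ring
  rw [h1, h2]
  ring

/-- Telescope along the arc from `j` to `i`, which uses each edge of the cycle at most once. -/
theorem sub_le_sum_abs_sub (f : ZMod n → ℝ) (i j : ZMod n) :
    f i - f j ≤ ∑ k, |f k - f (k + 1)| := by
  have h1 : ∀ m : ℕ, f (j + m) - f j ≤ ∑ k ∈ Finset.range m, |f (j + k) - f (j + k + 1)| := by
    intro m
    induction m with
    | zero => simp
    | succ m ih =>
      rw [Finset.sum_range_succ]
      have := neg_abs_le (f (j + m) - f (j + m + 1))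
      push_cast
      rw [← add_assoc]
      linarith
  have h2 := h1 (i - j).val
  rw [ZMod.natCast_zmod_val, add_sub_cancel] at h2
  refine h2.trans ?_
  rw [← Finset.sum_image (f := fun k => |f k - f (k + 1)|) (g := fun k : ℕ => j + (k : ZMod n))]
  · exact Finset.sum_le_sum_of_subset_of_nonneg (Finset.subset_univ _) fun _ _ _ => abs_nonneg _
  · intro a ha b hb hab
    have hlt := ZMod.val_lt (i - j)
    have ha' : a < n := (Finset.mem_range.1 ha).trans hlt
    have hb' : b < n := (Finset.mem_range.1 hb).trans hlt
    have h3 : (a : ZMod n) = b := add_left_cancel hab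
    have h4 := congrArg ZMod.val h3
    rwa [ZMod.val_natCast_of_lt ha', ZMod.val_natCast_of_lt hb'] at h4

theorem exists_mem_add_one_notMem {A : Set (ZMod n)} (h1 : A.Nonempty) (h2 : A ≠ Set.univ) :
    ∃ i ∈ A, i + 1 ∉ A := by
  by_contra! hcon
  obtain ⟨i, hi⟩ := h1
  refine h2 (Set.eq_univ_of_forall fun j => ?_)
  have h3 : ∀ m : ℕ, i + m ∈ A := by
    intro m
    induction m with
    | zero => simpa
    | succ m ih =>
      have := hcon _ ih
      push_cast
      rwa [← add_assoc]
  have := h3 (j - i).val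
  rwa [ZMod.natCast_zmod_val, add_sub_cancel] at this

end Cycle

/-! ### The cycle with parallel edges. -/

section ThickCycle

variable {n m : ℕ}

theorem isLink_thickCycle (e : ZMod n × Fin m) : (thickCycle n m).IsLink e e.1 (e.1 + 1) :=
  Or.inl ⟨rfl, rfl⟩

theorem edgeSet_thickCycle : E(thickCycle n m) = Set.univ :=
  Set.eq_univ_of_forall fun e => (isLink_thickCycle e).edge_mem

theorem vertexSet_thickCycle : V(thickCycle n m) = Set.univ := rfl

theorem add_one_ne_self (hn : 2 ≤ n) (i : ZMod n) : i + 1 ≠ i := by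
  have : Fact (1 < n) := ⟨hn⟩
  simp

theorem setOf_inc_thickCycle (x : ZMod n) :
    {e | (thickCycle n m).Inc e x} = ({x, x - 1} : Set (ZMod n)) ×ˢ Set.univ := by
  ext e
  simp only [Set.mem_ofPred_eq, Graph.Inc, thickCycle, Set.mem_prod, Set.mem_insert_iff,
    Set.mem_singleton_iff, Set.mem_univ, and_true, eq_sub_iff_add_eq]
  constructor
  · rintro ⟨y, ⟨h, -⟩ | ⟨h, -⟩⟩
    exacts [Or.inl h.symm, Or.inr h.symm]
  · rintro (h | h)
    exacts [⟨e.1 + 1, Or.inl ⟨h.symm, rfl⟩⟩, ⟨e.1, Or.inr ⟨h.symm, rfl⟩⟩]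

theorem isRegular_thickCycle (hn : 2 ≤ n) : IsRegular (thickCycle n m) (2 * m) := by
  intro x _
  have h1 : {e | (thickCycle n m).IsLoopAt e x} = ∅ := by
    rw [Set.eq_empty_iff_forall_notMem]
    rintro e (⟨h, h2⟩ | ⟨h, h2⟩)
    · exact add_one_ne_self hn e.1 (h2.symm.trans h)
    · exact add_one_ne_self hn e.1 (h.symm.trans h2)
  have h2 : x ≠ x - 1 := fun h => add_one_ne_self hn (x - 1) (by rw [sub_add_cancel, ← h])
  rw [degree, h1, setOf_inc_thickCycle, Set.ncard_prod, Set.ncard_pair h2]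
  simp [Set.ncard_univ]

/-- Leaving `A` once already crosses `m` parallel edges, which suffices for sets of any size. -/
theorem isoperimetric_thickCycle {γ : ℝ} (hγ : 0 < γ) (hn : n ≠ 0) (hm : (n : ℝ) ^ γ ≤ m) :
    Isoperimetric (thickCycle n m) γ 1 := by
  have : NeZero n := ⟨hn⟩
  intro A _ hA
  rw [vertexSet_thickCycle, Set.ncard_univ, Nat.card_zmod] at hA
  rcases A.eq_empty_or_nonempty with rfl | hne
  · simp [Real.zero_rpow hγ.ne']
  have hAu : A ≠ Set.univ := by
    rintro rfl
    rw [Set.ncard_univ, Nat.card_zmod] at hA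
    omega
  obtain ⟨i, hi, hi2⟩ := exists_mem_add_one_notMem hne hAu
  have hsub : ({i} : Set (ZMod n)) ×ˢ (Set.univ : Set (Fin m)) ⊆
      edgeBoundary (thickCycle n m) A := by
    rintro e ⟨he, -⟩
    obtain rfl : e.1 = i := he
    exact ⟨e.1, hi, e.1 + 1, ⟨trivial, hi2⟩, isLink_thickCycle e⟩
  have h1 := Set.ncard_le_ncard hsub
  rw [Set.ncard_prod, Set.ncard_singleton, Set.ncard_univ, Nat.card_fin, one_mul] at h1
  calc 1 * (A.ncard : ℝ) ^ γ ≤ (n : ℝ) ^ γ := by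
        rw [one_mul]
        gcongr
        omega
    _ ≤ m := hm
    _ ≤ _ := by exact_mod_cast h1

theorem le_maxCommuteTime_thickCycle (hn : n ≠ 0) (hm : 0 < m) :
    ENNReal.ofReal (((n : ℝ) ^ 2 - 1) / (12 * m)) ≤ maxCommuteTime (thickCycle n m) := by
  have : NeZero n := ⟨hn⟩
  have hV : vertices (thickCycle n m) = Finset.univ := by
    ext x; simp [vertexSet_thickCycle]
  have hE : edges (thickCycle n m) = Finset.univ := by
    ext e; simp [edgeSet_thickCycle]
  have hm' : (0 : ℝ) < m := by exact_mod_cast hm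
  have hn' : (0 : ℝ) < n := by exact_mod_cast Nat.pos_of_ne_zero hn
  have key := le_maxCommuteTime (G := thickCycle n m) (u := 0) trivial
    (fun x _ => ⟨(x, ⟨0, hm⟩), mem_incEdges.2 (isLink_thickCycle _).inc_left⟩)
    (fun e _ => isLink_thickCycle e) (φ := parabola n) parabola_zero
    (c := 2 * m) (by positivity) ?_
  · refine le_trans (le_of_eq ?_) key
    rw [hV, sum_parabola, vertexSet_thickCycle, Set.ncard_univ, Nat.card_zmod]
    congr 1
    field_simp
    ring
  · intro h h0
    rw [hV, hE, Fintype.sum_prod_type]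
    simp only [Finset.sum_const, Finset.card_univ, Fintype.card_fin, nsmul_eq_mul]
    rw [← Finset.mul_sum]
    have := sum_parabola_energy_le h0
    nlinarith

theorem lt_maxCommuteTime_thickCycle (hn : 3 ≤ n) :
    ENNReal.ofReal (1 / 100 * (n : ℝ) ^ (4 / 3 : ℝ)) <
      maxCommuteTime (thickCycle n ⌈(n : ℝ) ^ (2 / 3 : ℝ)⌉₊) := by
  have hn' : (3 : ℝ) ≤ n := by exact_mod_cast hn
  -- In terms of `x`, the bound to beat is a multiple of `x ^ 2`, while `n ^ 2 = x ^ 3` and the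
  -- multiplicity is at most `2 * x`.
  set x : ℝ := (n : ℝ) ^ (2 / 3 : ℝ) with hx
  have hx1 : 1 ≤ x := Real.one_le_rpow (by linarith) (by norm_num)
  have hx2 : (n : ℝ) ^ (4 / 3 : ℝ) = x ^ 2 := by
    rw [hx, ← Real.rpow_natCast, ← Real.rpow_mul (by linarith)]
    norm_num
  have hx3 : (n : ℝ) ^ 2 = x ^ 3 := by
    rw [hx, ← Real.rpow_natCast, ← Real.rpow_natCast, ← Real.rpow_mul (by linarith)]
    norm_num
  have hm : 0 < ⌈x⌉₊ := Nat.ceil_pos.2 (by linarith)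
  have hm2 : (⌈x⌉₊ : ℝ) ≤ 2 * x := by linarith [Nat.ceil_lt_add_one (by linarith : 0 ≤ x)]
  have hm' : (0 : ℝ) < ⌈x⌉₊ := by exact_mod_cast hm
  refine lt_of_lt_of_le ?_ (le_maxCommuteTime_thickCycle (by omega) hm)
  have h9 : 9 ≤ x ^ 3 := by rw [← hx3]; nlinarith
  have hlt : 1 / 100 * (n : ℝ) ^ (4 / 3 : ℝ) < ((n : ℝ) ^ 2 - 1) / (12 * ⌈x⌉₊) := by
    rw [hx2, hx3, lt_div_iff₀ (by positivity)]
    calc 1 / 100 * x ^ 2 * (12 * ⌈x⌉₊) ≤ 1 / 100 * x ^ 2 * (12 * (2 * x)) := by gcongr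
      _ < x ^ 3 - 1 := by nlinarith
  exact (ENNReal.ofReal_lt_ofReal_iff_of_nonneg (by positivity)).2 hlt

end ThickCycle

/-! ### The blown-up cycle: an example without multiple edges. -/

section Fiber

variable {α : Type u} {β : Type w}

/-- The part of a set of pairs over a first component. -/
def fiber (A : Set (α × β)) (i : α) : Set β := {b | (i, b) ∈ A}

theorem ncard_eq_sum_fiber [Fintype α] [Finite β] (A : Set (α × β)) :
    A.ncard = ∑ i, (fiber A i).ncard := by
  classical
  have := Fintype.ofFinite β
  simp_rw [Set.ncard_eq_toFinset_card', ← Set.filter_mem_univ_eq_toFinset, Finset.card_filter]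
  exact Fintype.sum_prod_type _

end Fiber

section BlowUp

variable {l s : ℕ}

/-- The cycle of length `l` with every vertex replaced by `s` independent vertices. -/
def blowUpCycle (l s : ℕ) : Graph (ZMod l × Fin s) (ZMod l × Fin s × Fin s) where
  vertexSet := Set.univ
  IsLink e x y := (x = (e.1, e.2.1) ∧ y = (e.1 + 1, e.2.2)) ∨
    (x = (e.1 + 1, e.2.2) ∧ y = (e.1, e.2.1))
  isLink_symm _ _ := ⟨fun _ _ h => by tauto⟩
  eq_or_eq_of_isLink_of_isLink _ _ _ _ _ h h' := by grind
  left_mem_of_isLink _ _ _ _ := Set.mem_univ _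

theorem isLink_blowUpCycle (e : ZMod l × Fin s × Fin s) :
    (blowUpCycle l s).IsLink e (e.1, e.2.1) (e.1 + 1, e.2.2) :=
  Or.inl ⟨rfl, rfl⟩

theorem edgeSet_blowUpCycle : E(blowUpCycle l s) = Set.univ :=
  Set.eq_univ_of_forall fun e => (isLink_blowUpCycle e).edge_mem

theorem vertexSet_blowUpCycle : V(blowUpCycle l s) = Set.univ := rfl

theorem add_one_add_one_ne_self (hl : 3 ≤ l) (i : ZMod l) : i + 1 + 1 ≠ i := by
  intro h
  have h2 : ((2 : ℕ) : ZMod l) = 0 := by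
    have : i + (1 + 1) = i + 0 := by rw [← add_assoc, h, add_zero]
    have := add_left_cancel this
    push_cast
    rw [← this]
    norm_num
  have := Nat.le_of_dvd two_pos ((ZMod.natCast_eq_zero_iff 2 l).1 h2)
  omega

theorem simple_blowUpCycle (hl : 3 ≤ l) : (blowUpCycle l s).Simple where
  not_isLoopAt := by
    rintro e x (⟨h, h2⟩ | ⟨h, h2⟩)
    · exact add_one_ne_self (by omega) e.1 (congrArg Prod.fst (h2.symm.trans h))
    · exact add_one_ne_self (by omega) e.1 (congrArg Prod.fst (h.symm.trans h2))
  eq_of_isLink := by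
    have key : ∀ e f : ZMod l × Fin s × Fin s, (e.1, e.2.1) = (f.1 + 1, f.2.2) →
        (e.1 + 1, e.2.2) = (f.1, f.2.1) → False := by
      intro e f h1 h2
      have h3 : e.1 = f.1 + 1 := congrArg Prod.fst h1
      have h4 : e.1 + 1 = f.1 := congrArg Prod.fst h2
      exact add_one_add_one_ne_self hl f.1 (by rw [← h3, h4])
    rintro e f x y (⟨rfl, rfl⟩ | ⟨rfl, rfl⟩) (⟨h1, h2⟩ | ⟨h1, h2⟩)
    · simp only [Prod.mk.injEq] at h1 h2
      exact Prod.ext h1.1 (Prod.ext h1.2 h2.2)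
    · exact (key e f h1 h2).elim
    · exact (key e f h2 h1).elim
    · simp only [Prod.mk.injEq] at h1 h2
      exact Prod.ext h2.1 (Prod.ext h2.2 h1.2)

theorem isRegular_blowUpCycle (hl : 2 ≤ l) : IsRegular (blowUpCycle l s) (2 * s) := by
  have : NeZero l := ⟨by omega⟩
  rintro ⟨i, a⟩ _
  have h1 : {e | (blowUpCycle l s).IsLoopAt e (i, a)} = ∅ := by
    rw [Set.eq_empty_iff_forall_notMem]
    rintro e (⟨h, h2⟩ | ⟨h, h2⟩)
    · exact add_one_ne_self hl e.1 (congrArg Prod.fst (h2.symm.trans h))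
    · exact add_one_ne_self hl e.1 (congrArg Prod.fst (h.symm.trans h2))
  have h2 : {e | (blowUpCycle l s).Inc e (i, a)} =
      ({i} : Set (ZMod l)) ×ˢ (({a} : Set (Fin s)) ×ˢ (Set.univ : Set (Fin s))) ∪
      ({i - 1} : Set (ZMod l)) ×ˢ ((Set.univ : Set (Fin s)) ×ˢ ({a} : Set (Fin s))) := by
    ext e
    simp only [Set.mem_ofPred_eq, Graph.Inc, blowUpCycle, Set.mem_union, Set.mem_prod,
      Set.mem_singleton_iff, Set.mem_univ, and_true, true_and, eq_sub_iff_add_eq, Prod.mk.injEq]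
    constructor
    · rintro ⟨y, ⟨h, -⟩ | ⟨h, -⟩⟩
      exacts [Or.inl ⟨h.1.symm, h.2.symm⟩, Or.inr ⟨h.1.symm, h.2.symm⟩]
    · rintro (h | h)
      exacts [⟨(e.1 + 1, e.2.2), Or.inl ⟨⟨h.1.symm, h.2.symm⟩, rfl⟩⟩,
        ⟨(e.1, e.2.1), Or.inr ⟨⟨h.1.symm, h.2.symm⟩, rfl⟩⟩]
  have h3 : i ≠ i - 1 := fun h => add_one_ne_self hl (i - 1) (by rw [sub_add_cancel, ← h])
  rw [degree, h1, h2, Set.ncard_union_eq]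
  · simp [Set.ncard_prod, Set.ncard_univ, two_mul]
  · rw [Set.disjoint_left]
    rintro e ⟨he, -⟩ ⟨he2, -⟩
    exact h3 (he.symm.trans he2)

variable [NeZero l]

theorem sum_fiber_le_ncard_edgeBoundary (A : Set (ZMod l × Fin s)) :
    ∑ i, ((fiber A i).ncard * (s - (fiber A (i + 1)).ncard : ℝ) +
      (s - (fiber A i).ncard) * (fiber A (i + 1)).ncard) ≤
        ((edgeBoundary (blowUpCycle l s) A).ncard : ℝ) := by
  rw [ncard_eq_sum_fiber]
  push_cast
  refine Finset.sum_le_sum fun i _ => ?_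
  have hsub : fiber A i ×ˢ (fiber A (i + 1))ᶜ ∪ (fiber A i)ᶜ ×ˢ fiber A (i + 1) ⊆
      fiber (edgeBoundary (blowUpCycle l s) A) i := by
    rintro ⟨b, c⟩ (⟨h1, h2⟩ | ⟨h1, h2⟩)
    · exact ⟨(i, b), h1, (i + 1, c), ⟨trivial, h2⟩, isLink_blowUpCycle (i, b, c)⟩
    · exact ⟨(i + 1, c), h2, (i, b), ⟨trivial, h1⟩, (isLink_blowUpCycle (i, b, c)).symm⟩
  have hdisj : Disjoint (fiber A i ×ˢ (fiber A (i + 1))ᶜ) ((fiber A i)ᶜ ×ˢ fiber A (i + 1)) := by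
    rw [Set.disjoint_left]
    rintro ⟨b, c⟩ ⟨h1, -⟩ ⟨h2, -⟩
    exact h2 h1
  have h := Set.ncard_le_ncard hsub
  rw [Set.ncard_union_eq hdisj, Set.ncard_prod, Set.ncard_prod] at h
  have hc : ∀ B : Set (Fin s), (Bᶜ.ncard : ℝ) = s - B.ncard := fun B => by
    have := Set.ncard_add_ncard_compl B
    rw [Nat.card_fin] at this
    rw [eq_sub_iff_add_eq', ← Nat.cast_add, this]
  rw [← hc, ← hc]
  exact_mod_cast h

/-- If every fibre is at most half full, each point of `A` accounts for `s` boundary edges.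
Otherwise some fibre `i` is more than half full and some fibre `j` at most half full. The boundary
is then at least `s * (s - a i) + s * a j` locally and at least `s * (a i - a j)` by going around
the cycle; these add up to `s ^ 2`. -/
theorem isoperimetric_blowUpCycle {γ : ℝ} (hγ : 0 < γ) (hγ1 : γ ≤ 1) (hs : 0 < s)
    (h : ((l * s : ℕ) : ℝ) ^ γ ≤ (s : ℝ) ^ 2) :
    Isoperimetric (blowUpCycle l s) γ (1 / 2) := by
  intro A _ hA
  rw [vertexSet_blowUpCycle, Set.ncard_univ, Nat.card_prod, Nat.card_zmod, Nat.card_fin] at hA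
  refine le_trans ?_ (sum_fiber_le_ncard_edgeBoundary A)
  let a : ZMod l → ℝ := fun i => (fiber A i).ncard
  have hs' : (1 : ℝ) ≤ s := by exact_mod_cast hs
  have ha0 : ∀ i, 0 ≤ a i := fun i => Nat.cast_nonneg _
  have has : ∀ i, a i ≤ s := fun i => by
    have := Set.ncard_le_ncard (Set.subset_univ (fiber A i))
    rw [Set.ncard_univ, Nat.card_fin] at this
    exact Nat.cast_le.2 this
  have hsum : (A.ncard : ℝ) = ∑ i, a i := by
    rw [ncard_eq_sum_fiber]
    push_cast
    rfl
  let β : ZMod l → ℝ := fun i => a i * (s - a (i + 1)) + (s - a i) * a (i + 1)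
  change 1 / 2 * (A.ncard : ℝ) ^ γ ≤ ∑ i, β i
  have hβ0 : ∀ i, 0 ≤ β i := fun i => add_nonneg
    (mul_nonneg (ha0 _) (sub_nonneg.2 (has _))) (mul_nonneg (sub_nonneg.2 (has _)) (ha0 _))
  have hβ1 : ∀ i, 2 * a i ≤ s → s * a i ≤ β i := fun i hi => by
    have := mul_nonneg (ha0 (i + 1)) (sub_nonneg.2 hi)
    simp only [β]
    linarith
  have hβ2 : ∀ i, (s : ℝ) ≤ 2 * a i → s * (s - a i) ≤ β i := fun i hi => by
    have := mul_nonneg (sub_nonneg.2 (has (i + 1))) (sub_nonneg.2 hi)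
    simp only [β]
    linarith
  have hβ3 : ∀ i, s * |a i - a (i + 1)| ≤ β i := fun i => by
    have h1 := mul_nonneg (ha0 (i + 1)) (sub_nonneg.2 (has i))
    have h2 := mul_nonneg (ha0 i) (sub_nonneg.2 (has (i + 1)))
    simp only [β]
    rcases abs_cases (a i - a (i + 1)) with ⟨h3, -⟩ | ⟨h3, -⟩ <;> rw [h3] <;> linarith
  have hApow : (A.ncard : ℝ) ^ γ ≤ A.ncard := by
    rcases Nat.eq_zero_or_pos A.ncard with h0 | h0
    · simp [h0, Real.zero_rpow hγ.ne']
    · exact Real.rpow_le_self_of_one_le (by exact_mod_cast h0) hγ1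
  by_cases hall : ∀ i, 2 * a i ≤ s
  · have h1 : ∑ i, s * a i ≤ ∑ i, β i := Finset.sum_le_sum fun i _ => hβ1 i (hall i)
    rw [← Finset.mul_sum, ← hsum] at h1
    have h2 : (0 : ℝ) ≤ A.ncard := Nat.cast_nonneg _
    nlinarith
  push Not at hall
  obtain ⟨i, hi⟩ := hall
  obtain ⟨j, hj⟩ : ∃ j, 2 * a j ≤ s := by
    by_contra! hcon
    have h1 : ∑ _k : ZMod l, (s : ℝ) < ∑ k, 2 * a k :=
      Finset.sum_lt_sum_of_nonempty Finset.univ_nonempty fun k _ => hcon k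
    rw [← Finset.mul_sum, ← hsum, Finset.sum_const, Finset.card_univ, ZMod.card,
      nsmul_eq_mul] at h1
    have h2 : 2 * (A.ncard : ℝ) ≤ l * s := by exact_mod_cast hA
    linarith
  have hij : i ≠ j := by
    rintro rfl
    linarith
  have h1 : s * (s - a i) + s * a j ≤ ∑ k, β k := by
    calc s * (s - a i) + s * a j ≤ β i + β j := add_le_add (hβ2 i hi.le) (hβ1 j hj)
      _ = ∑ k ∈ {i, j}, β k := (Finset.sum_pair hij).symm
      _ ≤ _ := Finset.sum_le_sum_of_subset_of_nonneg (Finset.subset_univ _) fun k _ _ => hβ0 k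
  have h2 : s * (a i - a j) ≤ ∑ k, β k := by
    calc s * (a i - a j) ≤ s * ∑ k, |a k - a (k + 1)| := by
          gcongr
          exact sub_le_sum_abs_sub a i j
      _ = ∑ k, s * |a k - a (k + 1)| := by rw [Finset.mul_sum]
      _ ≤ _ := Finset.sum_le_sum fun k _ => hβ3 k
  have h3 : (A.ncard : ℝ) ^ γ ≤ (s : ℝ) ^ 2 := by
    refine le_trans ?_ h
    gcongr
    omega
  nlinarith

theorem le_maxCommuteTime_blowUpCycle (hs : 0 < s) :
    ENNReal.ofReal (((l : ℝ) ^ 2 - 1) / (12 * s)) ≤ maxCommuteTime (blowUpCycle l s) := by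
  have hV : vertices (blowUpCycle l s) = Finset.univ := by
    ext x; simp [vertexSet_blowUpCycle]
  have hE : edges (blowUpCycle l s) = Finset.univ := by
    ext e; simp [edgeSet_blowUpCycle]
  have hs' : (0 : ℝ) < s := by exact_mod_cast hs
  have hl' : (0 : ℝ) < l := by exact_mod_cast Nat.pos_of_ne_zero (NeZero.ne l)
  have key := le_maxCommuteTime (G := blowUpCycle l s) (u := (0, ⟨0, hs⟩)) trivial
    (fun x _ => ⟨(x.1, x.2, ⟨0, hs⟩), mem_incEdges.2 (isLink_blowUpCycle _).inc_left⟩)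
    (fun e _ => isLink_blowUpCycle e) (φ := fun x => parabola l x.1) parabola_zero
    (c := 2 * s) (by positivity) ?_
  · refine le_trans (le_of_eq ?_) key
    rw [hV, Fintype.sum_prod_type, vertexSet_blowUpCycle, Set.ncard_univ, Nat.card_prod,
      Nat.card_zmod, Nat.card_fin]
    simp only [Finset.sum_const, Finset.card_univ, Fintype.card_fin, nsmul_eq_mul]
    rw [← Finset.mul_sum, sum_parabola]
    congr 1
    push_cast
    field_simp
    ring
  · intro h h0
    rw [hV, hE, Fintype.sum_prod_type, Fintype.sum_prod_type]
    -- As the test function is constant on fibres, only the fibre sums of `h` matter, and the energy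
    -- is `s` times that on the plain cycle.
    have h1 : ∀ i : ZMod l, ∑ p : Fin s × Fin s, (parabola l i - parabola l (i + 1)) *
        (h (i, p.1) - h (i + 1, p.2)) =
        s * ((parabola l i - parabola l (i + 1)) * (∑ a, h (i, a) - ∑ a, h (i + 1, a))) := by
      intro i
      rw [← Finset.mul_sum, Finset.sum_sub_distrib, Fintype.sum_prod_type, Fintype.sum_prod_type]
      simp only [Finset.sum_const, Finset.card_univ, Fintype.card_fin, nsmul_eq_mul,
        ← Finset.mul_sum]
      ring
    rw [Finset.sum_congr rfl fun i _ => h1 i, ← Finset.mul_sum]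
    have := sum_parabola_energy_le (h := fun i : ZMod l => ∑ a, h (i, a))
      fun i => Finset.sum_nonneg fun a _ => h0 _
    nlinarith

end BlowUp

/-- Simple regular graphs of unbounded degree with an isoperimetric inequality of exponent above
`1 / 2` can have mean commute times that are not linear. -/
theorem exists_simple_lt_maxCommuteTime (K : ℝ) :
    ∃ (V E : Type) (_ : Finite V) (_ : Finite E) (G : Graph V E) (d : ℕ),
      G.Simple ∧ IsRegular G d ∧ Isoperimetric G (4 / 7) (1 / 2) ∧
        ENNReal.ofReal (K * (V(G).ncard : ℝ)) < maxCommuteTime G := by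
  obtain ⟨r, hr⟩ := exists_nat_gt (12 * |K| + 3)
  have hK := abs_nonneg K
  have hr3 : (3 : ℝ) < r := by linarith
  have hr3' : 3 < r := by exact_mod_cast hr3
  have hl3 : 3 ≤ r ^ 5 := hr3'.le.trans (Nat.le_self_pow (by norm_num) r)
  have hs : 0 < r ^ 2 := by positivity
  have : NeZero (r ^ 5) := ⟨by omega⟩
  -- There are `r ^ 7` vertices, and `(r ^ 7) ^ (4 / 7) = (r ^ 2) ^ 2` is what the isoperimetric
  -- bound needs. The commute time is of order at least `r ^ 10 / r ^ 2 = r ^ 8`.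
  refine ⟨_, _, inferInstance, inferInstance, blowUpCycle (r ^ 5) (r ^ 2), 2 * r ^ 2,
    simple_blowUpCycle hl3, isRegular_blowUpCycle (by omega),
    isoperimetric_blowUpCycle (by norm_num) (by norm_num) hs ?_, ?_⟩
  · rw [← pow_add]
    push_cast
    rw [← Real.rpow_natCast, ← Real.rpow_mul (by linarith), ← pow_mul, ← Real.rpow_natCast]
    norm_num
  · refine lt_of_lt_of_le ?_ (le_maxCommuteTime_blowUpCycle hs)
    have h2 : (1 : ℝ) < r ^ 10 := one_lt_pow₀ (by linarith) (by norm_num)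
    rw [vertexSet_blowUpCycle, Set.ncard_univ, Nat.card_prod, Nat.card_zmod, Nat.card_fin,
      ENNReal.ofReal_lt_ofReal_iff]
    · push_cast
      rw [lt_div_iff₀ (by positivity)]
      have h3 : K ≤ |K| := le_abs_self K
      have h4 : (0 : ℝ) < r ^ 9 := by positivity
      have h5 : (1 : ℝ) ≤ r ^ 9 := one_le_pow₀ (by linarith)
      have h6 : K * ((r : ℝ) ^ 5 * r ^ 2) * (12 * r ^ 2) = 12 * K * r ^ 9 := by ring
      have h7 : ((r : ℝ) ^ 5) ^ 2 = r * r ^ 9 := by ring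
      rw [h6, h7]
      nlinarith
    · push_cast
      have h7 : ((r : ℝ) ^ 5) ^ 2 = r ^ 10 := by ring
      rw [h7]
      exact div_pos (by linarith) (by positivity)

end MeanCommute

theorem mainTheorem2 :
    -- bounded degree: the maximal mean commute time is at most linear
    (∀ (γ δ : ℝ) (D : ℕ), 1 / 2 < γ → γ < 1 → 0 < δ →
      ∃ K : ℝ, 0 < K ∧
        ∀ (V : Type u) (E : Type w) [Finite V] [Finite E] (G : Graph V E) (d : ℕ),
          d ≤ D → MeanCommute.IsRegular G d → MeanCommute.Isoperimetric G γ δ →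
            MeanCommute.maxCommuteTime G ≤ ENNReal.ofReal (K * (V(G).ncard : ℝ))) ∧
    -- unbounded degree: the cycle with `⌈n ^ (2 / 3)⌉` parallel edges between neighbours
    (∃ c : ℝ, 0 < c ∧ ∀ n : ℕ, 3 ≤ n →
      MeanCommute.IsRegular (MeanCommute.thickCycle n ⌈(n : ℝ) ^ (2 / 3 : ℝ)⌉₊)
          (2 * ⌈(n : ℝ) ^ (2 / 3 : ℝ)⌉₊) ∧
        MeanCommute.Isoperimetric (MeanCommute.thickCycle n ⌈(n : ℝ) ^ (2 / 3 : ℝ)⌉₊) (2 / 3) 1 ∧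
        ENNReal.ofReal (c * (n : ℝ) ^ (4 / 3 : ℝ)) <
          MeanCommute.maxCommuteTime (MeanCommute.thickCycle n ⌈(n : ℝ) ^ (2 / 3 : ℝ)⌉₊)) ∧
    -- unbounded degree: the claim also fails for graphs without multiple edges
    (∃ γ δ : ℝ, 1 / 2 < γ ∧ γ < 1 ∧ 0 < δ ∧ ∀ K : ℝ,
      ∃ (V E : Type) (_ : Finite V) (_ : Finite E) (G : Graph V E) (d : ℕ),
        G.Simple ∧ MeanCommute.IsRegular G d ∧ MeanCommute.Isoperimetric G γ δ ∧
          ENNReal.ofReal (K * (V(G).ncard : ℝ)) < MeanCommute.maxCommuteTime G) := by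
  refine ⟨fun γ δ D hγ hγ1 hδ => MeanCommute.maxCommuteTime_le D hγ hγ1 hδ,
    ⟨1 / 100, by norm_num, fun n hn => ⟨MeanCommute.isRegular_thickCycle (by omega),
      MeanCommute.isoperimetric_thickCycle (by norm_num) (by omega) (Nat.le_ceil _),
      MeanCommute.lt_maxCommuteTime_thickCycle hn⟩⟩,
    ⟨4 / 7, 1 / 2, by norm_num, by norm_num, by norm_num,
      MeanCommute.exists_simple_lt_maxCommuteTime⟩⟩
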